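/- Let $R$ be a commutative ring and let $\mathcal I'\subseteq\mathcal I$ and $\mathcal J'\subseteq\mathcal J$ be ideals of $R$ such that each of the pairs $\{\mathcal I,\mathcal J\}$, $\{\mathcal I',\mathcal J\}$, $\{\mathcal I,\mathcal J'\}$ is Tor-independent, where ideals $\mathfrak a,\mathfrak b$ are called Tor-independent if $\operatorname{Tor}_i^R(R/\mathfrak a,R/\mathfrak b)=0$ for all $i\ge 1$. Let $\mathcal X,\mathcal Y,\mathscr S,\mathscr T$ be free resolutions over $R$ of $R/\mathcal I$, $R/\mathcal J$, $R/\mathcal I'$, $R/\mathcal J'$ respectively, each equal to $R$ in degree $0$ with augmentation the canonical surjection from $R$, and let $\phi:\mathscr S\to\mathcal X$ and $\psi:\mathscr T\to\mathcal Y$ be chain maps with $\phi_0=\mathrm{id}_R$ and $\psi_0=\mathrm{id}_R$ (so they lift the surjections $R/\mathcal I'\to R/\mathcal I$ and $R/\mathcal J'\to R/\mathcal J$). For a complex $C$ let $C_{\ge 1}$ be its hard truncation (replace $C_i$ by $0$ for $i\leq 0$), let $(\Sigma^{-1}C)_n=C_{n+1}$ with differential $-\partial^C$, and let tensor products of complexes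 have differential $\partial(a\otimes b)=\partial a\otimes b+(-1)^{|a|}a\otimes\partial b$. The star product $\mathcal X\star\mathcal Y$ is the complex with $(\mathcal X\star\mathcal Y)_n=(\mathcal X_{\ge1}\otimes_R\mathcal Y_{\ge1})_{n+1}$ for $n\ge1$, $(\mathcal X\star\mathcal Y)_0=\mathcal X_0\otimes_R\mathcal Y_0$, and $0$ for $n<0$, whose differential is $\partial_{n+1}^{\mathcal X_{\ge1}\otimes\mathcal Y_{\ge1}}$ in degrees $n\ge2$ and $\partial_1^{\mathcal X}\otimes\partial_1^{\mathcal Y}$ in degree $1$; write $\alpha\star\beta$ for the element of $\mathcal X\star\mathcal Y$ given by a simple tensor $\alpha\otimes\beta$. Define chain maps $\Phi:\Sigma^{-1}(\mathscr S_{\ge1}\otimes_R\mathcal Y)\to\mathcal X\star\mathcal Y$ and $\Psi:\Sigma^{-1}(\mathcal X\otimes_R\mathscr T_{\ge1})\to\mathcal X\star\mathcal Y$ by $$\Phi(\alpha\otimes\beta)=\begin{cases}(-1)^{|\alpha|+|\beta|}\,\phi(\alpha)\star\beta & |\beta|>0\\ \partial_1^{\mathscr S}(\alpha)\star\beta & |\beta|=0,\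 |\alpha|=1\\ 0&|\beta|=0,\ |\alpha|>1\end{cases}\qquad \Psi(\alpha\otimes\beta)=\begin{cases}(-1)^{|\alpha|+|\beta|-1}\,\alpha\star\psi(\beta) & |\alpha|>0\\ \alpha\star\partial_1^{\mathscr T}(\beta) & |\alpha|=0,\ |\beta|=1\\ 0&|\alpha|=0,\ |\beta|>1,\end{cases}$$ where $|\cdot|$ denotes the degree in $\mathcal X,\mathcal Y,\mathscr S,\mathscr T$, and set $$\Omega=\begin{pmatrix}\Phi&\Psi\end{pmatrix}:\Sigma^{-1}(\mathscr S_{\ge1}\otimes_R\mathcal Y)\oplus\Sigma^{-1}(\mathcal X\otimes_R\mathscr T_{\ge1})\longrightarrow\mathcal X\star\mathcal Y .$$ Then the mapping cone $\operatorname{Cone}(\Omega)$ is a free resolution of $R/\langle\mathcal I',\mathcal I\mathcal J,\mathcal J'\rangle$ over $R$; its augmentation is the identification $\operatorname{Cone}(\Omega)_0=\mathcal X_0\otimes_R\mathcal Y_0=R\otimes_R R\cong R$ followed by the canonical surjection $R\to R/\langle\mathcal I',\mathcal I\mathcal J,\mathcal J'\rangle$. -/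

import Mathlib

open CategoryTheory CategoryTheory.Limits MonoidalCategory

universe u

namespace StarResolution

variable {R : Type u} [CommRing R]

/-- Chain complexes of `R`-modules concentrated in non-negative degrees. -/
abbrev Cx (R : Type u) [CommRing R] := ChainComplex (ModuleCat.{u} R) ℕ

/-- `F` is a free resolution of the `R`-module `M` with augmentation `ε : F₀ → M`: the modules
`Fₙ` are free and `⋯ → F₂ → F₁ → F₀ → M → 0` is exact. -/
structure IsFreeResolution (F : Cx R) {M : Type u} [AddCommGroup M] [Module R M]
    (ε : F.X 0 →ₗ[R] M) : Prop where
  free : ∀ n, Module.Free R (F.X n)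
  exact_succ : ∀ n, Function.Exact (F.d (n + 2) (n + 1)) (F.d (n + 1) n)
  exact_zero : Function.Exact (F.d 1 0) ε
  surjective : Function.Surjective ε

/-- Two modules are Tor-independent if `Torᵢ(M, N) = 0` for all `i ≥ 1`. -/
def TorIndependent (M N : ModuleCat.{u} R) : Prop :=
  ∀ i : ℕ, 1 ≤ i → IsZero (((Tor (ModuleCat.{u} R) i).obj M).obj N)

/-- Two ideals `I`, `J` of `R` are Tor-independent if the modules `R/I` and `R/J` are. -/
def IdealTorIndependent (I J : Ideal R) : Prop :=
  TorIndependent (ModuleCat.of R (R ⧸ I)) (ModuleCat.of R (R ⧸ J))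

noncomputable section

/-- The tensor product of chain complexes, with differential
`∂(a ⊗ b) = ∂a ⊗ b + (-1)^|a| a ⊗ ∂b`. -/
abbrev tens (X Y : Cx R) : Cx R := HomologicalComplex.tensorObj X Y

/-- The tensor product of two chain maps. -/
abbrev tensMap {X X' Y Y' : Cx R} (f : X ⟶ X') (g : Y ⟶ Y') : tens X Y ⟶ tens X' Y' :=
  HomologicalComplex.tensorHom f g

/-- The inclusion of the summand `X_p ⊗ Y_q` in degree `n = p + q` of the tensor product. -/
abbrev tensIncl (X Y : Cx R) (p q n : ℕ) (h : p + q = n) : X.X p ⊗ Y.X q ⟶ (tens X Y).X n :=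
  HomologicalComplex.ιTensorObj X Y p q n h

/-- The map out of degree `n` of a tensor product with given components on the
summands `X_p ⊗ Y_q`, `p + q = n`. -/
def tensDesc (X Y : Cx R) {A : ModuleCat.{u} R} (n : ℕ)
    (f : ∀ p q : ℕ, p + q = n → (X.X p ⊗ Y.X q ⟶ A)) : (tens X Y).X n ⟶ A :=
  HomologicalComplex.mapBifunctorDesc f

@[simp]
lemma tensIncl_desc (X Y : Cx R) {A : ModuleCat.{u} R} (n : ℕ)
    (f : ∀ p q : ℕ, p + q = n → (X.X p ⊗ Y.X q ⟶ A)) (p q : ℕ) (h : p + q = n) :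
    tensIncl X Y p q n h ≫ tensDesc X Y n f = f p q h :=
  HomologicalComplex.ι_mapBifunctorDesc _ _ _ _

lemma tens_ext {X Y : Cx R} {A : ModuleCat.{u} R} {n : ℕ} {f g : (tens X Y).X n ⟶ A}
    (h : ∀ (p q : ℕ) (hpq : p + q = n), tensIncl X Y p q n hpq ≫ f = tensIncl X Y p q n hpq ≫ g) :
    f = g :=
  HomologicalComplex.mapBifunctor.hom_ext h

lemma tensIncl_d_succ_succ (X Y : Cx R) (p q n : ℕ) (h : p + 1 + (q + 1) = n + 1) :
    tensIncl X Y (p + 1) (q + 1) (n + 1) h ≫ (tens X Y).d (n + 1) n =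
      (X.d (p + 1) p ▷ Y.X (q + 1)) ≫ tensIncl X Y p (q + 1) n (by omega) +
        (-1 : ℤˣ) ^ (p + 1) •
          ((X.X (p + 1) ◁ Y.d (q + 1) q) ≫ tensIncl X Y (p + 1) q n (by omega)) := by
  rw [HomologicalComplex.mapBifunctor.d_eq, Preadditive.comp_add,
    HomologicalComplex.mapBifunctor.ι_D₁, HomologicalComplex.mapBifunctor.ι_D₂,
    HomologicalComplex.mapBifunctor.d₁_eq _ _ _ _ (i₁' := p) (by simp) _ _
      (show p + (q + 1) = n by omega),
    HomologicalComplex.mapBifunctor.d₂_eq _ _ _ _ _ (i₂' := q) (by simp) _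
      (show p + 1 + q = n by omega)]
  exact congrArg₂ HAdd.hAdd (one_smul ℤˣ _) rfl

lemma tensIncl_d_succ_zero (X Y : Cx R) (p n : ℕ) (h : p + 1 + 0 = n + 1) :
    tensIncl X Y (p + 1) 0 (n + 1) h ≫ (tens X Y).d (n + 1) n =
      (X.d (p + 1) p ▷ Y.X 0) ≫ tensIncl X Y p 0 n (by omega) := by
  rw [HomologicalComplex.mapBifunctor.d_eq, Preadditive.comp_add,
    HomologicalComplex.mapBifunctor.ι_D₁, HomologicalComplex.mapBifunctor.ι_D₂,
    HomologicalComplex.mapBifunctor.d₁_eq _ _ _ _ (i₁' := p) (by simp) _ _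
      (show p + 0 = n by omega),
    HomologicalComplex.mapBifunctor.d₂_eq_zero _ _ _ _ _ _ _ (by simp), add_zero]
  exact one_smul ℤˣ _

lemma tensIncl_d_zero_succ (X Y : Cx R) (q n : ℕ) (h : 0 + (q + 1) = n + 1) :
    tensIncl X Y 0 (q + 1) (n + 1) h ≫ (tens X Y).d (n + 1) n =
      (X.X 0 ◁ Y.d (q + 1) q) ≫ tensIncl X Y 0 q n (by omega) := by
  rw [HomologicalComplex.mapBifunctor.d_eq, Preadditive.comp_add,
    HomologicalComplex.mapBifunctor.ι_D₁, HomologicalComplex.mapBifunctor.ι_D₂,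
    HomologicalComplex.mapBifunctor.d₁_eq_zero _ _ _ _ _ _ _ (by simp),
    HomologicalComplex.mapBifunctor.d₂_eq _ _ _ _ _ (i₂' := q) (by simp) _
      (show 0 + q = n by omega), zero_add]
  exact one_smul ℤˣ _

lemma tensIncl_map {X X' Y Y' : Cx R} (f : X ⟶ X') (g : Y ⟶ Y') (p q n : ℕ) (h : p + q = n) :
    tensIncl X Y p q n h ≫ (tensMap f g).f n =
      (f.f p ⊗ₘ g.f q) ≫ tensIncl X' Y' p q n h := by
  rw [HomologicalComplex.ι_mapBifunctorMap]
  exact (MonoidalCategory.tensorHom_def (f.f p) (g.f q) =≫ _).trans (Category.assoc _ _ _) |>.symm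

/-- The hard truncation `X_{≥ 1}`. -/
def trunc (X : Cx R) : Cx R where
  X n := match n with
    | 0 => ModuleCat.of R PUnit
    | n + 1 => X.X (n + 1)
  d i j := match i, j with
    | i + 1, j + 1 => X.d (i + 1) (j + 1)
    | 0, _ => 0
    | _, 0 => 0
  shape i j h := by
    match i, j with
    | i + 1, j + 1 => exact X.shape _ _ h
    | 0, _ => rfl
    | i + 1, 0 => rfl
  d_comp_d' i j k _ _ := by
    match i, j, k with
    | i + 1, j + 1, k + 1 => exact X.d_comp_d _ _ _
    | 0, _, _ => exact zero_comp
    | _ + 1, 0, _ => exact zero_comp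
    | _ + 1, _ + 1, 0 => exact comp_zero

/-- The chain map `X_{≥ 1} → Y_{≥ 1}` induced by a chain map `X → Y`. -/
def truncMap {X Y : Cx R} (f : X ⟶ Y) : trunc X ⟶ trunc Y where
  f n := match n with
    | 0 => 𝟙 _
    | n + 1 => f.f (n + 1)
  comm' i j _ := by
    match i, j with
    | i + 1, j + 1 => exact f.comm _ _
    | 0, j => exact (comp_zero).trans zero_comp.symm
    | i + 1, 0 => exact (comp_zero).trans zero_comp.symm

/-- The projection `X → X_{≥ 1}`: the identity in positive degrees. -/
def truncProj (X : Cx R) : X ⟶ trunc X where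
  f n := match n with
    | 0 => 0
    | n + 1 => 𝟙 (X.X (n + 1))
  comm' i j _ := by
    match i, j with
    | i + 1, j + 1 => exact (Category.id_comp _).trans (Category.comp_id _).symm
    | 0, j => exact (comp_zero).trans (by rw [X.shape 0 j (by simp), zero_comp])
    | i + 1, 0 => exact (comp_zero).trans comp_zero.symm

/-- The desuspension `Σ⁻¹ C`, i.e. `(Σ⁻¹ C)ₙ = Cₙ₊₁` with differential `-∂`. It is only applied
to complexes `C` with `C₀ = 0`, so nothing is lost by not recording degree `-1`. -/
def desusp (C : Cx R) : Cx R where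
  X n := C.X (n + 1)
  d i j := -C.d (i + 1) (j + 1)
  shape i j h := by rw [C.shape _ _ (by simpa using h), neg_zero]
  d_comp_d' i j k _ _ := by simp

/-- The components of `∂₁ ⊗ ∂₁` on the summands of `(X_{≥ 1} ⊗ Y_{≥ 1})₂`. The summands
indexed by `(0, 2)` and `(2, 0)` are zero modules. -/
def starAugAux (X Y : Cx R) : ∀ p q : ℕ, (trunc X).X p ⊗ (trunc Y).X q ⟶ X.X 0 ⊗ Y.X 0
  | 1, 1 => X.d 1 0 ⊗ₘ Y.d 1 0
  | _, _ => 0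

/-- The map `∂₁ ⊗ ∂₁ : (X_{≥ 1} ⊗ Y_{≥ 1})₂ = X₁ ⊗ Y₁ → X₀ ⊗ Y₀`. -/
def starAug (X Y : Cx R) : (tens (trunc X) (trunc Y)).X 2 ⟶ X.X 0 ⊗ Y.X 0 :=
  tensDesc (trunc X) (trunc Y) 2 fun p q _ => starAugAux X Y p q


lemma trunc_tensor_ext (X : Cx R) {A B : ModuleCat.{u} R} (f g : (trunc X).X 0 ⊗ A ⟶ B) :
    f = g := by
  have h : 𝟙 ((trunc X).X 0) = 0 :=
    (ModuleCat.isZero_of_subsingleton (ModuleCat.of R PUnit)).eq_of_src _ _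
  rw [← Category.id_comp f, ← Category.id_comp g, ← MonoidalCategory.id_whiskerRight, h]
  simp

lemma tensor_trunc_ext (X : Cx R) {A B : ModuleCat.{u} R} (f g : A ⊗ (trunc X).X 0 ⟶ B) :
    f = g := by
  have h : 𝟙 ((trunc X).X 0) = 0 :=
    (ModuleCat.isZero_of_subsingleton (ModuleCat.of R PUnit)).eq_of_src _ _
  rw [← Category.id_comp f, ← Category.id_comp g, ← MonoidalCategory.whiskerLeft_id, h]
  simp

lemma d_starAug (X Y : Cx R) :
    (tens (trunc X) (trunc Y)).d 3 2 ≫ starAug X Y = 0 := by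
  apply tens_ext
  intro p q h
  obtain ⟨rfl, rfl⟩ | ⟨rfl, rfl⟩ | ⟨rfl, rfl⟩ | ⟨rfl, rfl⟩ :
      p = 0 ∧ q = 3 ∨ p = 3 ∧ q = 0 ∨ p = 1 ∧ q = 2 ∨ p = 2 ∧ q = 1 := by omega
  · exact trunc_tensor_ext _ _ _
  · exact tensor_trunc_ext _ _ _
  · have e : X.X 1 ◁ Y.d 2 1 ≫ (X.d 1 0 ⊗ₘ Y.d 1 0) = 0 := by
      rw [MonoidalCategory.tensorHom_def', ← MonoidalCategory.whiskerLeft_comp_assoc]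
      simp
    rw [← Category.assoc, tensIncl_d_succ_succ]
    simp only [starAug, Preadditive.add_comp, Category.assoc, tensIncl_desc,
      Linear.units_smul_comp, show starAugAux X Y 0 (1 + 1) = 0 from rfl, comp_zero, zero_add]
    have e' : (trunc X).X (0 + 1) ◁ (trunc Y).d (1 + 1) 1 ≫ starAugAux X Y (0 + 1) 1 = 0 := e
    rw [e', smul_zero]
  · have e : X.d 2 1 ▷ Y.X 1 ≫ (X.d 1 0 ⊗ₘ Y.d 1 0) = 0 := by
      rw [MonoidalCategory.tensorHom_def, ← MonoidalCategory.comp_whiskerRight_assoc]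
      simp
    rw [← Category.assoc, tensIncl_d_succ_succ]
    simp only [starAug, Preadditive.add_comp, Category.assoc, tensIncl_desc,
      Linear.units_smul_comp, show starAugAux X Y (1 + 1) 0 = 0 from rfl, comp_zero, smul_zero,
      add_zero]
    exact e

/-- The star product `X ⋆ Y`: in degree `n ≥ 1` it is `(X_{≥ 1} ⊗ Y_{≥ 1})ₙ₊₁`, with the
differential of `X_{≥ 1} ⊗ Y_{≥ 1}` in degrees `≥ 2`; in degree `0` it is `X₀ ⊗ Y₀`, and the
differential in degree `1` is `∂₁ ⊗ ∂₁`. -/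
def star (X Y : Cx R) : Cx R where
  X n := match n with
    | 0 => X.X 0 ⊗ Y.X 0
    | n + 1 => (tens (trunc X) (trunc Y)).X (n + 2)
  d i j := match i, j with
    | i + 1, j + 1 => (tens (trunc X) (trunc Y)).d (i + 2) (j + 2)
    | 1, 0 => starAug X Y
    | 0, _ => 0
    | _ + 2, 0 => 0
  shape i j h := by
    match i, j with
    | i + 1, j + 1 =>
      exact (tens (trunc X) (trunc Y)).shape _ _ (by simp at h ⊢; omega)
    | 1, 0 => simp at h
    | 0, _ => rfl
    | _ + 2, 0 => rfl
  d_comp_d' i j k hij hjk := by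
    match i, j, k with
    | i + 1, j + 1, k + 1 => exact (tens (trunc X) (trunc Y)).d_comp_d _ _ _
    | 2, 1, 0 => exact d_starAug X Y
    | i + 1, j + 2, 0 => simp at hjk
    | 0, _, _ => exact zero_comp
    | 1, 1, 0 => simp at hij
    | i + 3, 1, 0 => simp at hij
    | 1, 0, _ => simp at hjk
    | _ + 2, 0, _ => exact zero_comp

variable {S X T Y : Cx R}

/-- The components of the degree `0` part of `Φ`. The summand `(0, 1)` of
`(S_{≥ 1} ⊗ Y)₁` is a zero module. -/
def PhiAux (φ : S ⟶ X) (Y : Cx R) : ∀ p q : ℕ, (trunc S).X p ⊗ Y.X q ⟶ X.X 0 ⊗ Y.X 0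
  | 1, 0 => (S.d 1 0 ≫ φ.f 0) ▷ Y.X 0
  | _, _ => 0

/-- The degree `0` part of `Φ`: it sends `α ⊗ β` with `|α| = 1`, `|β| = 0` to
`φ₀(∂₁ α) ⊗ β`. -/
def PhiZero (φ : S ⟶ X) (Y : Cx R) : (tens (trunc S) Y).X 1 ⟶ X.X 0 ⊗ Y.X 0 :=
  tensDesc (trunc S) Y 1 fun p q _ => PhiAux φ Y p q

/-- The components of the degree `0` part of `Ψ`. The summand `(1, 0)` of
`(X ⊗ T_{≥ 1})₁` is a zero module. -/
def PsiAux (X : Cx R) (ψ : T ⟶ Y) : ∀ p q : ℕ, X.X p ⊗ (trunc T).X q ⟶ X.X 0 ⊗ Y.X 0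
  | 0, 1 => X.X 0 ◁ (T.d 1 0 ≫ ψ.f 0)
  | _, _ => 0

/-- The degree `0` part of `Ψ`: it sends `α ⊗ β` with `|α| = 0`, `|β| = 1` to
`α ⊗ ψ₀(∂₁ β)`. -/
def PsiZero (X : Cx R) (ψ : T ⟶ Y) : (tens X (trunc T)).X 1 ⟶ X.X 0 ⊗ Y.X 0 :=
  tensDesc X (trunc T) 1 fun p q _ => PsiAux X ψ p q

lemma PhiZero_comm (φ : S ⟶ X) (Y : Cx R) :
    (tensMap (truncMap φ) (truncProj Y)).f 2 ≫ starAug X Y =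
      -((tens (trunc S) Y).d 2 1 ≫ PhiZero φ Y) := by
  apply tens_ext
  intro p q h
  rw [Preadditive.comp_neg, ← Category.assoc, ← Category.assoc, tensIncl_map, Category.assoc]
  obtain ⟨rfl, rfl⟩ | ⟨rfl, rfl⟩ | ⟨rfl, rfl⟩ :
      p = 0 ∧ q = 2 ∨ p = 2 ∧ q = 0 ∨ p = 1 ∧ q = 1 := by omega
  · exact trunc_tensor_ext _ _ _
  · rw [tensIncl_d_succ_zero]
    simp only [starAug, PhiZero, Category.assoc, tensIncl_desc,
      show starAugAux X Y 2 0 = 0 from rfl, comp_zero]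
    have e : S.d 2 1 ▷ Y.X 0 ≫ (S.d 1 0 ≫ φ.f 0) ▷ Y.X 0 = 0 := by
      rw [← MonoidalCategory.comp_whiskerRight]
      simp
    exact (neg_eq_zero.mpr e).symm
  · rw [tensIncl_d_succ_succ]
    simp only [starAug, PhiZero, Preadditive.add_comp, Category.assoc, tensIncl_desc,
      show PhiAux φ Y 0 (0 + 1) = 0 from rfl, comp_zero, zero_add, pow_one,
      Units.neg_smul, one_smul, neg_neg, Preadditive.neg_comp]
    have e : (φ.f 1 ⊗ₘ 𝟙 (Y.X 1)) ≫ (X.d 1 0 ⊗ₘ Y.d 1 0) =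
        S.X 1 ◁ Y.d 1 0 ≫ (S.d 1 0 ≫ φ.f 0) ▷ Y.X 0 := by
      rw [← φ.comm, ← MonoidalCategory.tensorHom_def', MonoidalCategory.tensorHom_comp_tensorHom,
        Category.id_comp, φ.comm]
    exact e

lemma PsiZero_comm (X : Cx R) (ψ : T ⟶ Y) :
    (tensMap (truncProj X) (truncMap ψ)).f 2 ≫ starAug X Y =
      (tens X (trunc T)).d 2 1 ≫ PsiZero X ψ := by
  apply tens_ext
  intro p q h
  rw [← Category.assoc, ← Category.assoc, tensIncl_map, Category.assoc]
  obtain ⟨rfl, rfl⟩ | ⟨rfl, rfl⟩ | ⟨rfl, rfl⟩ :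
      p = 2 ∧ q = 0 ∨ p = 0 ∧ q = 2 ∨ p = 1 ∧ q = 1 := by omega
  · exact tensor_trunc_ext _ _ _
  · rw [tensIncl_d_zero_succ]
    simp only [starAug, PsiZero, Category.assoc, tensIncl_desc,
      show starAugAux X Y 0 2 = 0 from rfl, comp_zero]
    have e : X.X 0 ◁ T.d 2 1 ≫ X.X 0 ◁ (T.d 1 0 ≫ ψ.f 0) = 0 := by
      rw [← MonoidalCategory.whiskerLeft_comp]
      simp
    exact e.symm
  · rw [tensIncl_d_succ_succ]
    simp only [starAug, PsiZero, Preadditive.add_comp, Category.assoc, tensIncl_desc,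
      Linear.units_smul_comp, show PsiAux X ψ (0 + 1) 0 = 0 from rfl, comp_zero, smul_zero,
      add_zero]
    have e : (𝟙 (X.X 1) ⊗ₘ ψ.f 1) ≫ (X.d 1 0 ⊗ₘ Y.d 1 0) =
        X.d 1 0 ▷ T.X 1 ≫ X.X 0 ◁ (T.d 1 0 ≫ ψ.f 0) := by
      rw [← ψ.comm, ← MonoidalCategory.tensorHom_def, MonoidalCategory.tensorHom_comp_tensorHom,
        Category.id_comp, ψ.comm]
    exact e

/-- The components of `Φ : Σ⁻¹(S_{≥ 1} ⊗ Y) → X ⋆ Y`. In degree `0`, it sends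
`α ⊗ β` with `|α| = 1`, `|β| = 0` to `φ₀(∂₁ α) ⊗ β` (here `φ₀` is the identification `S₀ = X₀`).
In degree `n + 1`, it sends `α ⊗ β` with `|α| + |β| = n + 2` to `(-1)^(|α| + |β|) φ(α) ⋆ β` if
`|β| > 0`, and to `0` if `|β| = 0`. -/
def PhiF (φ : S ⟶ X) (Y : Cx R) : ∀ n, (desusp (tens (trunc S) Y)).X n ⟶ (star X Y).X n
  | 0 => PhiZero φ Y
  | n + 1 => (-1 : ℤˣ) ^ (n + 2) • (tensMap (truncMap φ) (truncProj Y)).f (n + 2)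

/-- The components of `Ψ : Σ⁻¹(X ⊗ T_{≥ 1}) → X ⋆ Y`. In degree `0`, it sends
`α ⊗ β` with `|α| = 0`, `|β| = 1` to `α ⊗ ψ₀(∂₁ β)` (here `ψ₀` is the identification `T₀ = Y₀`).
In degree `n + 1`, it sends `α ⊗ β` with `|α| + |β| = n + 2` to `(-1)^(|α| + |β| - 1) α ⋆ ψ(β)` if
`|α| > 0`, and to `0` if `|α| = 0`. -/
def PsiF (X : Cx R) (ψ : T ⟶ Y) : ∀ n, (desusp (tens X (trunc T))).X n ⟶ (star X Y).X n
  | 0 => PsiZero X ψ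
  | n + 1 => (-1 : ℤˣ) ^ (n + 1) • (tensMap (truncProj X) (truncMap ψ)).f (n + 2)

/-- The chain map `Φ : Σ⁻¹(S_{≥ 1} ⊗ Y) → X ⋆ Y`. -/
def Phi (φ : S ⟶ X) (Y : Cx R) : desusp (tens (trunc S) Y) ⟶ star X Y where
  f := PhiF φ Y
  comm' i j hij := by
    obtain rfl : j + 1 = i := hij
    match j with
    | 0 =>
      change ((-1 : ℤˣ) ^ 2 • (tensMap (truncMap φ) (truncProj Y)).f 2) ≫ starAug X Y =
        (-(tens (trunc S) Y).d 2 1) ≫ PhiZero φ Y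
      rw [Linear.units_smul_comp, Preadditive.neg_comp, PhiZero_comm]
      simp
    | j + 1 =>
      change ((-1 : ℤˣ) ^ (j + 3) • (tensMap (truncMap φ) (truncProj Y)).f (j + 3)) ≫
          (tens (trunc X) (trunc Y)).d (j + 3) (j + 2) =
        (-(tens (trunc S) Y).d (j + 3) (j + 2)) ≫
          ((-1 : ℤˣ) ^ (j + 2) • (tensMap (truncMap φ) (truncProj Y)).f (j + 2))
      rw [Linear.units_smul_comp, Linear.comp_units_smul, Preadditive.neg_comp,
        HomologicalComplex.Hom.comm, pow_succ _ (j + 2)]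
      simp

/-- The chain map `Ψ : Σ⁻¹(X ⊗ T_{≥ 1}) → X ⋆ Y`. -/
def Psi (X : Cx R) (ψ : T ⟶ Y) : desusp (tens X (trunc T)) ⟶ star X Y where
  f := PsiF X ψ
  comm' i j hij := by
    obtain rfl : j + 1 = i := hij
    match j with
    | 0 =>
      change ((-1 : ℤˣ) ^ 1 • (tensMap (truncProj X) (truncMap ψ)).f 2) ≫ starAug X Y =
        (-(tens X (trunc T)).d 2 1) ≫ PsiZero X ψ
      rw [Linear.units_smul_comp, Preadditive.neg_comp, PsiZero_comm]
      simp
    | j + 1 =>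
      change ((-1 : ℤˣ) ^ (j + 2) • (tensMap (truncProj X) (truncMap ψ)).f (j + 3)) ≫
          (tens (trunc X) (trunc Y)).d (j + 3) (j + 2) =
        (-(tens X (trunc T)).d (j + 3) (j + 2)) ≫
          ((-1 : ℤˣ) ^ (j + 1) • (tensMap (truncProj X) (truncMap ψ)).f (j + 2))
      rw [Linear.units_smul_comp, Linear.comp_units_smul, Preadditive.neg_comp,
        HomologicalComplex.Hom.comm, pow_succ _ (j + 1)]
      simp

/-- `Ω = (Φ Ψ) : Σ⁻¹(S_{≥ 1} ⊗ Y) ⊕ Σ⁻¹(X ⊗ T_{≥ 1}) → X ⋆ Y`. -/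
def Omega (φ : S ⟶ X) (ψ : T ⟶ Y) :
    desusp (tens (trunc S) Y) ⊞ desusp (tens X (trunc T)) ⟶ star X Y :=
  biprod.desc (Phi φ Y) (Psi X ψ)

/-- The mapping cone of a chain map `f : F → G`: in degree `n` it is `Fₙ₋₁ ⊕ Gₙ` (just `G₀` in
degree `0`), with differential `(a, b) ↦ (-∂a, f(a) + ∂b)`. -/
abbrev cone {F G : Cx R} (f : F ⟶ G) : Cx R := HomologicalComplex.homotopyCofiber f

/-- The identification `Cone(f)₀ = G₀`. -/
def coneZero {F G : Cx R} (f : F ⟶ G) : (cone f).X 0 ≅ G.X 0 :=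
  HomologicalComplex.homotopyCofiber.XIso f 0 (by simp)

/-- The identification `Cone(Ω)₀ = X₀ ⊗ Y₀ ≃ R ⊗ R ≃ R` obtained from identifications `X₀ ≃ R`
and `Y₀ ≃ R`. -/
def coneOmegaZero (φ : S ⟶ X) (ψ : T ⟶ Y) (eX : X.X 0 ≃ₗ[R] R) (eY : Y.X 0 ≃ₗ[R] R) :
    (cone (Omega φ ψ)).X 0 ≃ₗ[R] R :=
  (coneZero (Omega φ ψ)).toLinearEquiv ≪≫ₗ TensorProduct.congr eX eY ≪≫ₗ TensorProduct.lid R R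

end

end StarResolution

open StarResolution

/-! The long exact sequence of the cone reduces the claim to three facts: `X ⋆ Y` has no homology in
positive degrees, neither does the source of `Ω`, and `H₀(Ω)` is injective with cokernel `R/⟨I', IJ,
J'⟩`.

Tor-independence makes `X ⊗ Y`, `S ⊗ Y` and `X ⊗ T` exact in positive degrees
(`IsFreeResolution.exactAt_tensBicomplex`). Discarding the exact edge `S₀ ⊗ Y` keeps `S_{≥1} ⊗ Y`
exact in degrees at least 2. In degree 1 its homology embeds, through `∂₁`, into `H₀(S₀ ⊗ Y) = R/J`,
with image `(I' + J)/J` (`PhiZero_exists_d_eq`). Symmetrically, `H₁(X ⊗ T_{≥1})` is `(J' + I)/I`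
inside `R/I` (`PsiZero_exists_d_eq`). Truncating `X ⊗ Y` on both sides makes `X ⋆ Y` exact in
positive degrees (`star_exact_succ`), with `H₀ = R/IJ` because `∂₁ ⊗ ∂₁` has image `IJ`
(`range_starAug`).

Thus `H₀(Ω)` sends classes represented by `r ∈ I'` and `s ∈ J'` to `r + s` modulo `IJ`. If `r + s ∈
IJ ⊆ I ∩ J`, then `I' ⊆ I` and `J' ⊆ J` force `r ∈ J` and `s ∈ I`, so both classes vanish
(`mem_and_mem_of_add_mem_mul`). The cokernel can be read off from the images `I'`, `J'`, `IJ`. -/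

namespace StarResolution

/-! ### Diagram chases in a first quadrant double complex. -/

/-- A first quadrant double complex of `R`-modules with anticommuting differentials. -/
structure Bicomplex (R : Type u) [CommRing R] where
  obj : ℕ → ℕ → ModuleCat.{u} R
  dh : ∀ p q, obj (p + 1) q ⟶ obj p q
  dv : ∀ p q, obj p (q + 1) ⟶ obj p q
  dh_dh : ∀ p q (z : obj (p + 2) q), dh p q (dh (p + 1) q z) = 0
  dv_dv : ∀ p q (z : obj p (q + 2)), dv p q (dv p (q + 1) z) = 0
  anticomm : ∀ p q (z : obj (p + 1) (q + 1)), dh p q (dv (p + 1) q z) + dv p q (dh p (q + 1) z) = 0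

namespace Bicomplex

variable {R : Type u} [CommRing R] (Z : Bicomplex R)

/-- The total differential of a family of elements. -/
def tot (z : ∀ p q, Z.obj p q) (p q : ℕ) : Z.obj p q :=
  Z.dh p q (z (p + 1) q) + Z.dv p q (z p (q + 1))

/-- The total complex is exact in degree `n`. An element of degree `n` is represented by a family
of elements indexed by all bidegrees, of which only those with `p + q = n` matter. -/
def ExactAt (n : ℕ) : Prop :=
  ∀ z : ∀ p q, Z.obj p q, (∀ p q, p + q + 1 = n → Z.tot z p q = 0) →
    ∃ w : ∀ p q, Z.obj p q, ∀ p q, p + q = n → Z.tot w p q = z p q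

/-- The double complex with the two directions exchanged. -/
def swap : Bicomplex R where
  obj p q := Z.obj q p
  dh p q := Z.dv q p
  dv p q := Z.dh q p
  dh_dh p q := Z.dv_dv q p
  dv_dv p q := Z.dh_dh q p
  anticomm p q z := (add_comm _ _).trans (Z.anticomm q p z)

lemma ExactAt.swap {Z : Bicomplex R} {n : ℕ} (h : Z.ExactAt n) : Z.swap.ExactAt n := by
  intro z hz
  obtain ⟨w, hw⟩ := h (fun p q => z q p) fun p q hpq =>
    (add_comm _ _).trans (hz q p (by omega))
  exact ⟨fun p q => w q p, fun p q hpq => (add_comm _ _).trans (hw q p (by omega))⟩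

/-- The double complex with the column `p = 0` removed. -/
def tail : Bicomplex R where
  obj p q := Z.obj (p + 1) q
  dh p q := Z.dh (p + 1) q
  dv p q := Z.dv (p + 1) q
  dh_dh p q := Z.dh_dh (p + 1) q
  dv_dv p q := Z.dv_dv (p + 1) q
  anticomm p q := Z.anticomm (p + 1) q

/-- If the rows are exact in positive degrees and the complex of cokernels of the rows is exact in
degree `n`, then so is the total complex. -/
lemma exactAt_of_rows (n : ℕ)
    (hrow : ∀ p q (z : Z.obj (p + 1) q), Z.dh p q z = 0 → ∃ w, Z.dh (p + 1) q w = z)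
    (hcol : ∀ (z : Z.obj 0 (n + 1)) (y : Z.obj 1 n), Z.dh 0 n y + Z.dv 0 n z = 0 →
      ∃ w w', Z.dh 0 (n + 1) w + Z.dv 0 (n + 1) w' = z) :
    Z.ExactAt (n + 1) := by
  intro z hz
  suffices H : ∀ k, ∃ w : ∀ p q, Z.obj p q, ∀ p q, p ≤ k → p + q = n + 1 →
      Z.tot w p q = z p q by
    obtain ⟨w, hw⟩ := H (n + 1)
    exact ⟨w, fun p q hpq => hw p q (by omega) hpq⟩
  intro k
  induction k with
  | zero =>
    obtain ⟨w, w', h⟩ := hcol (z 0 (n + 1)) (z 1 n) (hz 0 n (by omega))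
    -- The total differential at `(0, n + 1)` sees only the entries `(1, n + 1)` and `(0, n + 2)`.
    let v : ∀ p q, Z.obj p q := fun p => match p with
      | 0 => Function.update (fun _ => 0) (n + 2) w'
      | 1 => Function.update (fun _ => 0) (n + 1) w
      | _ + 2 => fun _ => 0
    refine ⟨v, fun p q hp hpq => ?_⟩
    obtain rfl : p = 0 := by omega
    obtain rfl : q = n + 1 := by omega
    have h1 : v (0 + 1) (n + 1) = w := Function.update_self (β := fun q => Z.obj 1 q) (n + 1) w _
    have h2 : v 0 (n + 1 + 1) = w' := Function.update_self (β := fun q => Z.obj 0 q) (n + 2) w' _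
    rw [tot, h1, h2, h]
  | succ k ih =>
    obtain ⟨w, hw⟩ := ih
    by_cases hk : k + 1 ≤ n + 1
    swap
    · exact ⟨w, fun p q hp hpq => hw p q (by omega) hpq⟩
    obtain ⟨q, rfl⟩ : ∃ q, n = k + q := ⟨n - k, by omega⟩
    -- The error left in column `k + 1` is a horizontal cycle, since `z` is a total cycle and `w`
    -- already bounds it in column `k`.
    have h0 : Z.dh k q (z (k + 1) q - Z.dv (k + 1) q (w (k + 1) (q + 1))) = 0 := by
      have e1 := hz k q rfl
      have e2 := hw k (q + 1) le_rfl (by omega)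
      have e3 := Z.anticomm k q (w (k + 1) (q + 1))
      have e4 := Z.dv_dv k q (w k (q + 2))
      rw [tot, ← e2, tot, map_add, e4, add_zero] at e1
      rw [map_sub, eq_neg_of_add_eq_zero_left e1, eq_neg_of_add_eq_zero_left e3, sub_self]
    obtain ⟨y, hy⟩ := hrow k q _ h0
    -- Column `p` of the total differential involves `w` in columns `p` and `p + 1` only, so a
    -- change in column `k + 2` leaves columns up to `k` intact.
    refine ⟨Function.update w (k + 2) (Function.update (w (k + 2)) q y), fun p q' hp hpq => ?_⟩
    rcases Nat.lt_or_ge k p with h | h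
    · obtain rfl : p = k + 1 := by omega
      obtain rfl : q' = q := by omega
      rw [tot, Function.update_self, Function.update_self, Function.update_of_ne (by omega), hy,
        sub_add_cancel]
    · rw [← hw p q' h hpq, tot, tot, Function.update_of_ne (a := p) (by omega)]
      rcases Nat.lt_or_ge p k with h' | h'
      · rw [Function.update_of_ne (by omega)]
      · obtain rfl : p = k := by omega
        rw [Function.update_of_ne (by omega)]

/-- Removing a column that is exact in degree `n`. -/
lemma ExactAt.tail {Z : Bicomplex R} {n : ℕ} (h : Z.ExactAt (n + 2))
    (hcol : ∀ z, Z.dv 0 n z = 0 → ∃ w, Z.dv 0 (n + 1) w = z) : Z.tail.ExactAt (n + 1) := by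
  intro z hz
  have e1 : Z.dv 0 n (-Z.dh 0 (n + 1) (z 0 (n + 1))) = 0 := by
    have e1 := Z.anticomm 0 n (z 0 (n + 1))
    have e2 : Z.dh 1 n (z 1 n) + Z.dv 1 n (z 0 (n + 1)) = 0 := hz 0 n (by omega)
    have e3 : Z.dh 0 n (Z.dh 1 n (z 1 n)) = 0 := Z.dh_dh 0 n _
    rw [eq_neg_of_add_eq_zero_right e2, map_neg, e3, neg_zero, zero_add] at e1
    rw [map_neg, e1, neg_zero]
  obtain ⟨y, hy⟩ := hcol _ e1
  -- A cycle of the tail need not be a cycle of `Z`, its horizontal boundary in column 0 being the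
  -- obstruction. The entry `y` at `(0, n + 2)` cancels it.
  let z' : ∀ p q, Z.obj p q := fun p => match p with
    | 0 => Function.update (fun _ => 0) (n + 2) y
    | p + 1 => z p
  obtain ⟨w, hw⟩ := h z' fun p q hpq => by
    match p with
    | 0 =>
      obtain rfl : q = n + 1 := by omega
      have h2 : z' 0 (n + 1 + 1) = y := Function.update_self (β := fun q => Z.obj 0 q) (n + 2) y _
      rw [tot, h2, hy]
      exact add_neg_cancel _
    | p + 1 => exact hz p q (by omega)
  exact ⟨fun p => w (p + 1), fun p q hpq => hw (p + 1) q (by omega)⟩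

/-- The pair `(u, -v)` is a total cycle of degree 1, and `u` is the `(1, 0)` entry of the boundary
it equals. This handles the lowest degree of a complex truncated on one side, where exactness fails.
-/
lemma ExactAt.of_dh_mem {Z : Bicomplex R} (h : Z.ExactAt 1) (u : Z.obj 1 0) (v : Z.obj 0 1)
    (huv : Z.dh 0 0 u = Z.dv 0 0 v) : ∃ w w', Z.dh 1 0 w + Z.dv 1 0 w' = u := by
  let z : ∀ p q, Z.obj p q := fun p q => match p, q with
    | 1, 0 => u
    | 0, 1 => -v
    | _, _ => 0
  obtain ⟨w, hw⟩ := h z fun p q hpq => by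
    obtain rfl : p = 0 := by omega
    obtain rfl : q = 0 := by omega
    change Z.dh 0 0 u + Z.dv 0 0 (-v) = 0
    rw [map_neg, huv, add_neg_cancel]
  exact ⟨w 2 0, w 1 1, hw 1 0 rfl⟩

/-- Exactness of the two edges extends `u` to a total cycle `(-a, u, -b)` of degree 2. For a tensor
product the hypothesis `hu` says that `∂₁ ⊗ ∂₁` kills `u`, so this is exactness of the star product
in degree 1. -/
lemma ExactAt.of_dh_dv_eq_zero {Z : Bicomplex R} (h : Z.ExactAt 2)
    (hrow : ∀ z, Z.dh 0 0 z = 0 → ∃ w, Z.dh 1 0 w = z)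
    (hcol : ∀ z, Z.dv 0 0 z = 0 → ∃ w, Z.dv 0 1 w = z)
    (u : Z.obj 1 1) (hu : Z.dh 0 0 (Z.dv 1 0 u) = 0) :
    ∃ w w', Z.dh 1 1 w + Z.dv 1 1 w' = u := by
  have hu' : Z.dv 0 0 (Z.dh 0 1 u) = 0 := by
    have := Z.anticomm 0 0 u
    rwa [hu, zero_add] at this
  obtain ⟨a, ha⟩ := hrow _ hu
  obtain ⟨b, hb⟩ := hcol _ hu'
  let z : ∀ p q, Z.obj p q := fun p q => match p, q with
    | 2, 0 => -a
    | 1, 1 => u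
    | 0, 2 => -b
    | _, _ => 0
  obtain ⟨w, hw⟩ := h z fun p q hpq => by
    obtain ⟨rfl, rfl⟩ | ⟨rfl, rfl⟩ : p = 0 ∧ q = 1 ∨ p = 1 ∧ q = 0 := by omega
    · change Z.dh 0 1 u + Z.dv 0 1 (-b) = 0
      rw [map_neg, hb, add_neg_cancel]
    · change Z.dh 1 0 (-a) + Z.dv 1 0 u = 0
      rw [map_neg, ha, neg_add_cancel]
  exact ⟨w 2 1, w 1 2, hw 1 1 rfl⟩

end Bicomplex
end StarResolution

/-! ### Tensor products of complexes as total complexes, and their truncations. -/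

namespace StarResolution

noncomputable section

variable {R : Type u} [CommRing R]

lemma apply_eq_of_comp_eq {A B C D : ModuleCat.{u} R} {f : A ⟶ B} {g : B ⟶ D} {f' : A ⟶ C}
    {g' : C ⟶ D} (h : f ≫ g = f' ≫ g') (z : A) : g (f z) = g' (f' z) := by
  rw [← ConcreteCategory.comp_apply, h, ConcreteCategory.comp_apply]

lemma apply_eq_zero_of_comp_eq_zero {A B D : ModuleCat.{u} R} {f : A ⟶ B} {g : B ⟶ D}
    (h : f ≫ g = 0) (z : A) : g (f z) = 0 := by
  rw [← ConcreteCategory.comp_apply, h]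
  rfl

/-- The double complex whose total complex is the tensor product of `A` and `B`. -/
def tensBicomplex (A B : Cx R) : Bicomplex R where
  obj p q := A.X p ⊗ B.X q
  dh p q := A.d (p + 1) p ▷ B.X q
  dv p q := (-1 : ℤˣ) ^ p • (A.X p ◁ B.d (q + 1) q)
  dh_dh p q := apply_eq_zero_of_comp_eq_zero (by simp [← MonoidalCategory.comp_whiskerRight])
  dv_dv p q := apply_eq_zero_of_comp_eq_zero (by
    simp [← MonoidalCategory.whiskerLeft_comp, Linear.units_smul_comp, Linear.comp_units_smul])
  anticomm p q z := by
    have e : ((-1 : ℤˣ) ^ (p + 1) • (A.X (p + 1) ◁ B.d (q + 1) q)) ≫ A.d (p + 1) p ▷ B.X q =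
        -(A.d (p + 1) p ▷ B.X (q + 1) ≫ ((-1 : ℤˣ) ^ p • (A.X p ◁ B.d (q + 1) q))) := by
      rw [Linear.units_smul_comp, Linear.comp_units_smul, MonoidalCategory.whisker_exchange,
        pow_succ]
      simp
    have := ConcreteCategory.congr_hom e z
    exact (congrArg (· + _) this).trans (neg_add_cancel _)

/-- The projection of degree `n` of the tensor product to the summand `A_p ⊗ B_q`
(zero unless `p + q = n`). -/
def tensProj (A B : Cx R) (p q n : ℕ) : (tens A B).X n ⟶ A.X p ⊗ B.X q :=
  tensDesc A B n fun p' q' _ =>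
    if h : p' = p ∧ q' = q then eqToHom (by rw [h.1, h.2]) else 0

@[simp]
lemma tensIncl_proj (A B : Cx R) (p q n : ℕ) (h : p + q = n) :
    tensIncl A B p q n h ≫ tensProj A B p q n = 𝟙 _ := by
  rw [tensProj, tensIncl_desc, dif_pos ⟨rfl, rfl⟩, eqToHom_refl]

lemma tensIncl_proj_of_ne (A B : Cx R) (p q p' q' n : ℕ) (h : p' + q' = n)
    (hne : ¬ (p' = p ∧ q' = q)) :
    tensIncl A B p' q' n h ≫ tensProj A B p q n = 0 := by
  rw [tensProj, tensIncl_desc, dif_neg hne]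

/-- In coordinates the differential of the tensor product becomes `Bicomplex.tot`, which lets the
diagram chases be transported to `tens A B`. -/
lemma tens_d_proj (A B : Cx R) (p q n : ℕ) :
    (tens A B).d (n + 1) n ≫ tensProj A B p q n =
      tensProj A B (p + 1) q (n + 1) ≫ (tensBicomplex A B).dh p q +
        tensProj A B p (q + 1) (n + 1) ≫ (tensBicomplex A B).dv p q := by
  change _ = tensProj A B (p + 1) q (n + 1) ≫ (A.d (p + 1) p ▷ B.X q) +
    tensProj A B p (q + 1) (n + 1) ≫ ((-1 : ℤˣ) ^ p • (A.X p ◁ B.d (q + 1) q))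
  have hne {a b c : ℕ} (h : a + b = c) (h' : ¬ (a = p ∧ b = q)) :=
    tensIncl_proj_of_ne A B p q a b c h h'
  have hneh {a b c : ℕ} (h : a + b = c) (h' : ¬ (a = p + 1 ∧ b = q)) :=
    tensIncl_proj_of_ne A B (p + 1) q a b c h h'
  have hnev {a b c : ℕ} (h : a + b = c) (h' : ¬ (a = p ∧ b = q + 1)) :=
    tensIncl_proj_of_ne A B p (q + 1) a b c h h'
  apply tens_ext
  intro a b hab
  rw [Preadditive.comp_add, ← Category.assoc, ← Category.assoc, ← Category.assoc]
  match a, b with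
  | 0, 0 => omega
  | a + 1, 0 =>
    rw [tensIncl_d_succ_zero, Category.assoc, hnev hab (by omega), zero_comp]
    refine .trans ?_ (add_zero _).symm
    by_cases h : a = p ∧ 0 = q
    · obtain ⟨rfl, rfl⟩ := h
      simp
    · rw [hne _ h, hneh _ (by omega), zero_comp, comp_zero]
  | 0, b + 1 =>
    rw [tensIncl_d_zero_succ, Category.assoc, hneh hab (by omega), zero_comp]
    refine .trans ?_ (zero_add _).symm
    by_cases h : 0 = p ∧ b = q
    · obtain ⟨rfl, rfl⟩ := h
      simp
    · rw [hne _ h, hnev _ (by omega), zero_comp, comp_zero]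
  | a + 1, b + 1 =>
    rw [tensIncl_d_succ_succ, Preadditive.add_comp, Linear.units_smul_comp, Category.assoc,
      Category.assoc]
    by_cases h : a = p ∧ b + 1 = q
    · obtain ⟨rfl, rfl⟩ := h
      rw [hne (a := a + 1) (b := b) _ (by omega), hnev _ (by omega)]
      simp
    by_cases h' : a + 1 = p ∧ b = q
    · obtain ⟨rfl, rfl⟩ := h'
      rw [hne (a := a) (b := b + 1) _ (by omega), hneh _ (by omega)]
      simp [Linear.comp_units_smul]
    rw [hne _ h, hne _ h', hneh _ (by omega), hnev _ (by omega)]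
    simp

lemma tens_id_eq_sum (A B : Cx R) (n : ℕ) :
    𝟙 ((tens A B).X n) = ∑ x : Finset.HasAntidiagonal.antidiagonal n,
      tensProj A B x.1.1 x.1.2 n ≫
        tensIncl A B x.1.1 x.1.2 n (Finset.HasAntidiagonal.mem_antidiagonal.1 x.2) := by
  apply tens_ext
  intro p q h
  rw [Preadditive.comp_sum,
    Finset.sum_eq_single ⟨(p, q), Finset.HasAntidiagonal.mem_antidiagonal.2 h⟩]
  · rw [← Category.assoc, tensIncl_proj, Category.comp_id, Category.id_comp]
  · rintro ⟨⟨p', q'⟩, _⟩ - hne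
    rw [← Category.assoc, tensIncl_proj_of_ne, zero_comp]
    rintro ⟨rfl, rfl⟩
    exact hne rfl
  · simp

lemma tens_elem_ext {A B : Cx R} {n : ℕ} {z z' : (tens A B).X n}
    (h : ∀ p q, p + q = n → tensProj A B p q n z = tensProj A B p q n z') : z = z' := by
  have e (y : (tens A B).X n) : y = ∑ x : Finset.HasAntidiagonal.antidiagonal n,
      tensIncl A B x.1.1 x.1.2 n (Finset.HasAntidiagonal.mem_antidiagonal.1 x.2)
        (tensProj A B x.1.1 x.1.2 n y) := by
    have := ConcreteCategory.congr_hom (tens_id_eq_sum A B n) y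
    simpa using this
  rw [e z, e z']
  exact Finset.sum_congr rfl fun x _ => by rw [h _ _ (Finset.HasAntidiagonal.mem_antidiagonal.1 x.2)]

lemma exists_tens_elem {A B : Cx R} (n : ℕ) (z : ∀ p q, (A.X p ⊗ B.X q : ModuleCat R)) :
    ∃ y : (tens A B).X n, ∀ p q, p + q = n → tensProj A B p q n y = z p q := by
  refine ⟨∑ x : Finset.HasAntidiagonal.antidiagonal n,
      tensIncl A B x.1.1 x.1.2 n (Finset.HasAntidiagonal.mem_antidiagonal.1 x.2) (z _ _),
    fun p q h => ?_⟩
  rw [map_sum, Finset.sum_eq_single ⟨(p, q), Finset.HasAntidiagonal.mem_antidiagonal.2 h⟩]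
  · rw [← ConcreteCategory.comp_apply, tensIncl_proj]
    rfl
  · rintro ⟨⟨p', q'⟩, _⟩ - hne
    apply apply_eq_zero_of_comp_eq_zero
    apply tensIncl_proj_of_ne
    rintro ⟨rfl, rfl⟩
    exact hne rfl
  · simp

lemma tensProj_d_apply (A B : Cx R) (p q n : ℕ) (y : (tens A B).X (n + 1)) :
    tensProj A B p q n ((tens A B).d (n + 1) n y) =
      (tensBicomplex A B).dh p q (tensProj A B (p + 1) q (n + 1) y) +
        (tensBicomplex A B).dv p q (tensProj A B p (q + 1) (n + 1) y) :=
  ConcreteCategory.congr_hom (tens_d_proj A B p q n) y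

lemma tens_exists_of_exactAt {A B : Cx R} {n : ℕ} (h : (tensBicomplex A B).ExactAt (n + 1))
    (y : (tens A B).X (n + 1)) (hy : (tens A B).d (n + 1) n y = 0) :
    ∃ x, (tens A B).d (n + 2) (n + 1) x = y := by
  obtain ⟨w, hw⟩ := h (fun p q => tensProj A B p q (n + 1) y) fun p q hpq => by
    have := tensProj_d_apply A B p q n y
    rw [hy, map_zero] at this
    exact this.symm
  obtain ⟨x, hx⟩ := exists_tens_elem (n + 2) w
  refine ⟨x, tens_elem_ext fun p q hpq => ?_⟩
  rw [tensProj_d_apply, hx _ _ (by omega), hx _ _ (by omega)]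
  exact hw p q hpq

instance tens_free (A B : Cx R) [∀ n, Module.Free R (A.X n)] [∀ n, Module.Free R (B.X n)]
    (n : ℕ) : Module.Free R ((tens A B).X n) := by
  let f : (tens A B).X n →ₗ[R] ∀ x : Finset.HasAntidiagonal.antidiagonal n,
      TensorProduct R (A.X x.1.1) (B.X x.1.2) :=
    LinearMap.pi fun x => (tensProj A B x.1.1 x.1.2 n).hom
  have hf : Function.Bijective f := by
    constructor
    · intro y y' h
      exact tens_elem_ext fun p q hpq =>
        congrFun h ⟨(p, q), Finset.HasAntidiagonal.mem_antidiagonal.2 hpq⟩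
    · intro z
      obtain ⟨y, hy⟩ := exists_tens_elem (A := A) (B := B) n fun p q =>
        if h : p + q = n then z ⟨(p, q), Finset.HasAntidiagonal.mem_antidiagonal.2 h⟩ else 0
      refine ⟨y, funext fun x => ?_⟩
      have hx := Finset.HasAntidiagonal.mem_antidiagonal.1 x.2
      exact (hy _ _ hx).trans (dif_pos hx)
  exact Module.Free.of_equiv (LinearEquiv.ofBijective f hf).symm

instance trunc_free (A : Cx R) [∀ n, Module.Free R (A.X n)] (n : ℕ) :
    Module.Free R ((trunc A).X n) := by
  match n with
  | 0 => exact inferInstanceAs (Module.Free R PUnit.{u + 1})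
  | n + 1 => exact inferInstanceAs (Module.Free R (A.X (n + 1)))

lemma subsingleton_of_zero_left (A : Cx R) (B : ModuleCat.{u} R) :
    Subsingleton ((trunc A).X 0 ⊗ B : ModuleCat R) := by
  have : Subsingleton ((trunc A).X 0) := inferInstanceAs (Subsingleton PUnit)
  exact inferInstanceAs (Subsingleton (TensorProduct R _ _))

lemma subsingleton_of_zero_right (A : ModuleCat.{u} R) (B : Cx R) :
    Subsingleton (A ⊗ (trunc B).X 0 : ModuleCat R) := by
  have : Subsingleton ((trunc B).X 0) := inferInstanceAs (Subsingleton PUnit)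
  exact inferInstanceAs (Subsingleton (TensorProduct R _ _))

/-- Column 0 of the truncated double complex vanishes, and the others are the columns of the tail
shifted by one, with the same signs. Hence the shift of the total degree. -/
lemma exactAt_trunc_left {A B : Cx R} {n : ℕ} (h : (tensBicomplex A B).tail.ExactAt n) :
    (tensBicomplex (trunc A) B).ExactAt (n + 1) := by
  intro z hz
  obtain ⟨w, hw⟩ := h (fun p => z (p + 1)) fun p q hpq => hz (p + 1) q (by omega)
  refine ⟨fun p => match p with
    | 0 => fun _ => 0
    | p + 1 => w p, fun p q hpq => ?_⟩
  match p with
  | 0 => exact (subsingleton_of_zero_left A (B.X q)).elim _ _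
  | p + 1 => exact hw p q (by omega)

lemma exactAt_trunc_right {A B : Cx R} {n : ℕ}
    (h : (tensBicomplex A B).swap.tail.ExactAt n) :
    (tensBicomplex A (trunc B)).ExactAt (n + 1) := by
  intro z hz
  obtain ⟨w, hw⟩ := h (fun q p => z p (q + 1)) fun q p hpq =>
    (add_comm _ _).trans (hz p (q + 1) (by omega))
  refine ⟨fun p q => match q with
    | 0 => 0
    | q + 1 => w q p, fun p q hpq => ?_⟩
  match q with
  | 0 => exact (subsingleton_of_zero_right (A.X p) B).elim _ _
  | q + 1 => exact (add_comm _ _).trans (hw q p (by omega))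

lemma units_smul_apply {A B : ModuleCat.{u} R} (ε : ℤˣ) (f : A ⟶ B) (z : A) :
    (ε • f) z = ε • f z := by
  rcases Int.units_eq_one_or ε with rfl | rfl
  · rw [one_smul, one_smul]
  · rw [Units.neg_smul, Units.neg_smul, one_smul, one_smul]
    rfl

lemma tensBicomplex_dv_apply (A B : Cx R) (p q : ℕ) (z : (tensBicomplex A B).obj p (q + 1)) :
    (tensBicomplex A B).dv p q z = (-1 : ℤˣ) ^ p • (A.X p ◁ B.d (q + 1) q) z :=
  units_smul_apply _ _ _

lemma tensBicomplex_dv_zero_apply (A B : Cx R) (q : ℕ) (z : (tensBicomplex A B).obj 0 (q + 1)) :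
    (tensBicomplex A B).dv 0 q z = (A.X 0 ◁ B.d (q + 1) q) z :=
  (tensBicomplex_dv_apply A B 0 q z).trans (one_smul _ _)

lemma tensBicomplex_dv_eq_zero_iff (A B : Cx R) (p q : ℕ) (z : (tensBicomplex A B).obj p (q + 1)) :
    (tensBicomplex A B).dv p q z = 0 ↔ (A.X p ◁ B.d (q + 1) q) z = 0 := by
  rw [tensBicomplex_dv_apply]
  exact smul_eq_zero_iff_eq _

lemma tensBicomplex_dv_exists_iff (A B : Cx R) (p q : ℕ) (z : (tensBicomplex A B).obj p q) :
    (∃ w, (tensBicomplex A B).dv p q w = z) ↔ ∃ w, (A.X p ◁ B.d (q + 1) q) w = z := by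
  have e (w : (A.X p ⊗ B.X (q + 1) : ModuleCat R)) :
      (A.X p ◁ B.d (q + 1) q) ((-1 : ℤˣ) ^ p • w) = (-1 : ℤˣ) ^ p • (A.X p ◁ B.d (q + 1) q) w := by
    rcases neg_one_pow_eq_or ℤˣ p with h | h <;> rw [h]
    · rw [one_smul, one_smul]
    · rw [Units.neg_smul, Units.neg_smul, one_smul, one_smul, map_neg]
  constructor
  · rintro ⟨w, rfl⟩
    exact ⟨_, (e w).trans (tensBicomplex_dv_apply A B p q w).symm⟩
  · rintro ⟨w, rfl⟩
    refine ⟨(-1 : ℤˣ) ^ p • w, (tensBicomplex_dv_apply A B p q _).trans ?_⟩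
    rw [e, smul_smul, ← mul_pow]
    simp only [mul_neg, mul_one, neg_neg, one_pow, one_smul]
    rfl

lemma dh_exists_of_exact (A B : Cx R) [∀ n, Module.Free R (B.X n)] {p : ℕ}
    (h : Function.Exact (A.d (p + 2) (p + 1)) (A.d (p + 1) p)) (q : ℕ)
    (z : (tensBicomplex A B).obj (p + 1) q) (hz : (tensBicomplex A B).dh p q z = 0) :
    ∃ w, (tensBicomplex A B).dh (p + 1) q w = z :=
  ((Module.Flat.rTensor_exact (B.X q) (f := (A.d (p + 2) (p + 1)).hom)
    (g := (A.d (p + 1) p).hom) h) z).1 hz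

lemma dv_exists_of_exact (A B : Cx R) [∀ n, Module.Free R (A.X n)] {q : ℕ}
    (h : Function.Exact (B.d (q + 2) (q + 1)) (B.d (q + 1) q)) (p : ℕ)
    (z : (tensBicomplex A B).obj p (q + 1)) (hz : (tensBicomplex A B).dv p q z = 0) :
    ∃ w, (tensBicomplex A B).dv p (q + 1) w = z :=
  (tensBicomplex_dv_exists_iff A B p (q + 1) z).2
    (((Module.Flat.lTensor_exact (A.X p) (f := (B.d (q + 2) (q + 1)).hom)
      (g := (B.d (q + 1) q).hom) h) z).1 ((tensBicomplex_dv_eq_zero_iff A B p q z).1 hz))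

end
end StarResolution

/-! ### Tor-independence as exactness of a tensored resolution. -/

namespace StarResolution

noncomputable section

variable {R : Type u} [CommRing R]

/-- A free resolution as a projective resolution in the category of modules. -/
def IsFreeResolution.projectiveResolution {F : Cx R} {M : Type u} [AddCommGroup M] [Module R M]
    {ε : F.X 0 →ₗ[R] M} (h : IsFreeResolution F ε) : ProjectiveResolution (ModuleCat.of R M) where
  complex := F
  projective n := by
    have := h.free n
    exact (IsProjective.iff_projective _).1 (Module.Projective.of_free (P := F.X n))
  π := (ChainComplex.toSingle₀Equiv _ _).symm ⟨ModuleCat.ofHom ε, by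
    ext x
    exact h.exact_zero.apply_apply_eq_zero x⟩
  quasiIso := ⟨fun n => by
    cases n with
    | zero =>
      rw [ChainComplex.quasiIsoAt₀_iff, ShortComplex.quasiIso_iff_of_zeros']
      · let S := ShortComplex.mk (F.d 1 0) (ModuleCat.ofHom ε)
          (by ext x; exact h.exact_zero.apply_apply_eq_zero x)
        have hS : S.Exact ∧ Epi S.g :=
          ⟨(ShortComplex.ShortExact.moduleCat_exact_iff_function_exact _).2 h.exact_zero,
            (ModuleCat.epi_iff_surjective S.g).2 h.surjective⟩
        refine (ShortComplex.exact_and_epi_g_iff_of_iso ?_).2 hS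
        exact ShortComplex.isoMk (Iso.refl _) (Iso.refl _) (Iso.refl _)
          ((Category.id_comp _).trans (Category.comp_id _).symm)
          ((Category.id_comp _).trans (Category.comp_id _).symm)
      · exact F.shape _ _ (by simp)
      all_goals rfl
    | succ n =>
      rw [quasiIsoAt_iff_exactAt']
      · rw [HomologicalComplex.exactAt_iff' _ (n + 2) (n + 1) n (by simp) (by simp)]
        exact (ShortComplex.ShortExact.moduleCat_exact_iff_function_exact _).2 (h.exact_succ n)
      · apply ChainComplex.exactAt_succ_single_obj⟩

/-- `Tor` is the left derived functor of `N ⊗ -`, so it is computed by a resolution of the second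
argument. -/
lemma IsFreeResolution.lTensor_exact_of_torIndependent {F : Cx R} {M : Type u} [AddCommGroup M]
    [Module R M] {ε : F.X 0 →ₗ[R] M} (h : IsFreeResolution F ε) (N : Type u) [AddCommGroup N]
    [Module R N] (hN : TorIndependent (ModuleCat.of R N) (ModuleCat.of R M)) (n : ℕ) :
    Function.Exact (LinearMap.lTensor N (F.d (n + 2) (n + 1)).hom)
      (LinearMap.lTensor N (F.d (n + 1) n).hom) := by
  have h0 := (hN (n + 1) (by omega)).of_iso
    (h.projectiveResolution.isoLeftDerivedObj
      ((tensoringLeft (ModuleCat.{u} R)).obj (ModuleCat.of R N)) (n + 1)).symm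
  have h1 := (HomologicalComplex.exactAt_iff_isZero_homology _ _).2 h0
  rw [HomologicalComplex.exactAt_iff' _ (n + 2) (n + 1) n (by simp) (by simp)] at h1
  exact (ShortComplex.ShortExact.moduleCat_exact_iff_function_exact _).1 h1

end
end StarResolution

/-! ### Exactness of `A ⊗ B`, and the ideals that arise as images in degree 0. -/

namespace StarResolution

noncomputable section

variable {R : Type u} [CommRing R]

section Evaluation

variable {A B M N : Type*} [AddCommGroup A] [Module R A] [AddCommGroup B] [Module R B]
  [AddCommGroup M] [Module R M] [AddCommGroup N] [Module R N]

lemma range_lid_congr_map (eA : A ≃ₗ[R] R) (eB : B ≃ₗ[R] R) (f : M →ₗ[R] A) (g : N →ₗ[R] B)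
    {a b : Ideal R} (ha : LinearMap.range (eA.toLinearMap ∘ₗ f) = a)
    (hb : LinearMap.range (eB.toLinearMap ∘ₗ g) = b) :
    LinearMap.range ((TensorProduct.congr eA eB ≪≫ₗ TensorProduct.lid R R).toLinearMap ∘ₗ
      TensorProduct.map f g) = a * b := by
  subst ha hb
  apply le_antisymm
  · rintro _ ⟨z, rfl⟩
    induction z using TensorProduct.induction_on with
    | zero => simp
    | add x y hx hy =>
      rw [map_add]
      exact add_mem hx hy
    | tmul x y => exact Ideal.mul_mem_mul ⟨x, rfl⟩ ⟨y, rfl⟩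
  · rw [Ideal.mul_le]
    rintro _ ⟨x, rfl⟩ _ ⟨y, rfl⟩
    exact ⟨x ⊗ₜ y, rfl⟩

lemma range_comp_id (eA : A ≃ₗ[R] R) : LinearMap.range (eA.toLinearMap ∘ₗ LinearMap.id) = ⊤ :=
  LinearMap.range_eq_top.2 eA.surjective

end Evaluation

/-- By right exactness the cokernel of `A₁ ⊗ B → A₀ ⊗ B` is `M ⊗ B`. The image of `z` there is a
cycle, hence a boundary. A lift of the bounding element to `A₀ ⊗ B₂` corrects `z` to an element of
the kernel of `ε ⊗ B₁`, which is the image of `A₁ ⊗ B₁`. -/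
lemma exists_rTensor_add_lTensor {A₀ A₁ M B₀ B₁ B₂ : Type*} [AddCommGroup A₀] [Module R A₀]
    [AddCommGroup A₁] [Module R A₁] [AddCommGroup M] [Module R M] [AddCommGroup B₀] [Module R B₀]
    [AddCommGroup B₁] [Module R B₁] [AddCommGroup B₂] [Module R B₂]
    {d : A₁ →ₗ[R] A₀} {ε : A₀ →ₗ[R] M} {e₁ : B₁ →ₗ[R] B₀} {e₂ : B₂ →ₗ[R] B₁}
    (hA : Function.Exact d ε) (hε : Function.Surjective ε)
    (hB : Function.Exact (e₂.lTensor M) (e₁.lTensor M))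
    (z : TensorProduct R A₀ B₁) (y : TensorProduct R A₁ B₀)
    (h : d.rTensor B₀ y + e₁.lTensor A₀ z = 0) :
    ∃ w w', d.rTensor B₁ w + e₂.lTensor A₀ w' = z := by
  have h0 : e₁.lTensor M (ε.rTensor B₁ z) = 0 := by
    have := congrArg (ε.rTensor B₀) h
    rwa [map_add, (rTensor_exact B₀ hA hε).apply_apply_eq_zero, zero_add, map_zero,
      ← LinearMap.comp_apply, LinearMap.rTensor_comp_lTensor, ← LinearMap.lTensor_comp_rTensor,
      LinearMap.comp_apply] at this
  obtain ⟨m, hm⟩ := (hB _).1 h0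
  obtain ⟨w', rfl⟩ := LinearMap.rTensor_surjective B₂ hε m
  have h1 : ε.rTensor B₁ (z - e₂.lTensor A₀ w') = 0 := by
    rw [map_sub, ← hm, sub_eq_zero, ← LinearMap.comp_apply, LinearMap.lTensor_comp_rTensor,
      ← LinearMap.rTensor_comp_lTensor, LinearMap.comp_apply]
  obtain ⟨w, hw⟩ := (rTensor_exact B₁ hA hε _).1 h1
  exact ⟨w, w', by rw [hw, sub_add_cancel]⟩

lemma IsFreeResolution.range_d {A : Cx R} {a : Ideal R} {e : A.X 0 ≃ₗ[R] R}
    (h : IsFreeResolution A (a.mkQ ∘ₗ e.toLinearMap)) :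
    LinearMap.range (e.toLinearMap ∘ₗ (A.d 1 0).hom) = a := by
  ext r
  constructor
  · rintro ⟨x, rfl⟩
    exact (Submodule.Quotient.mk_eq_zero a).1 (h.exact_zero.apply_apply_eq_zero x)
  · intro hr
    obtain ⟨x, hx⟩ := (h.exact_zero (e.symm r)).1
      ((Submodule.Quotient.mk_eq_zero a).2 (by simpa using hr))
    exact ⟨x, (congrArg e hx).trans (e.apply_symm_apply r)⟩

/-- The rows are exact because each `B.X q` is flat, and their cokernels form `M ⊗ B`, whose
positive homology is `Tor(M, N)`. -/
lemma IsFreeResolution.exactAt_tensBicomplex {A B : Cx R} {M N : Type u} [AddCommGroup M]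
    [Module R M] [AddCommGroup N] [Module R N] {ε : A.X 0 →ₗ[R] M} {η : B.X 0 →ₗ[R] N}
    (hA : IsFreeResolution A ε) (hB : IsFreeResolution B η)
    (h : TorIndependent (ModuleCat.of R M) (ModuleCat.of R N)) (n : ℕ) :
    (tensBicomplex A B).ExactAt (n + 1) := by
  have := hB.free
  apply Bicomplex.exactAt_of_rows
  · exact fun p q z hz => dh_exists_of_exact A B (hA.exact_succ p) q z hz
  intro z y hzy
  have hzy' : LinearMap.rTensor (B.X n) (A.d 1 0).hom y +
      LinearMap.lTensor (A.X 0) (B.d (n + 1) n).hom z = 0 := by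
    rw [tensBicomplex_dv_apply] at hzy
    simpa using! hzy
  obtain ⟨w, w', hw⟩ := exists_rTensor_add_lTensor hA.exact_zero hA.surjective
    (hB.lTensor_exact_of_torIndependent M h n) z y hzy'
  exact ⟨w, w', (congrArg (_ + ·)
    (tensBicomplex_dv_zero_apply A B (n + 1) w')).trans hw⟩

lemma starAug_eq (X Y : Cx R) :
    starAug X Y = tensProj (trunc X) (trunc Y) 1 1 2 ≫ (X.d 1 0 ⊗ₘ Y.d 1 0) := by
  apply tens_ext
  intro p q h
  obtain ⟨rfl, rfl⟩ | ⟨rfl, rfl⟩ | ⟨rfl, rfl⟩ :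
      p = 0 ∧ q = 2 ∨ p = 2 ∧ q = 0 ∨ p = 1 ∧ q = 1 := by omega
  · exact trunc_tensor_ext _ _ _
  · exact tensor_trunc_ext _ _ _
  · rw [starAug, tensIncl_desc, ← Category.assoc, tensIncl_proj]
    exact (Category.id_comp _).symm

lemma PhiZero_eq {S X : Cx R} (φ : S ⟶ X) (Y : Cx R) :
    PhiZero φ Y = tensProj (trunc S) Y 1 0 1 ≫ ((S.d 1 0 ≫ φ.f 0) ▷ Y.X 0) := by
  apply tens_ext
  intro p q h
  obtain ⟨rfl, rfl⟩ | ⟨rfl, rfl⟩ : p = 0 ∧ q = 1 ∨ p = 1 ∧ q = 0 := by omega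
  · exact trunc_tensor_ext _ _ _
  · rw [PhiZero, tensIncl_desc]
    exact (((Category.assoc _ _ _).symm.trans (tensIncl_proj (trunc S) Y 1 0 1 h =≫ _)).trans
      (Category.id_comp _)).symm

lemma PsiZero_eq {T Y : Cx R} (X : Cx R) (ψ : T ⟶ Y) :
    PsiZero X ψ = tensProj X (trunc T) 0 1 1 ≫ (X.X 0 ◁ (T.d 1 0 ≫ ψ.f 0)) := by
  apply tens_ext
  intro p q h
  obtain ⟨rfl, rfl⟩ | ⟨rfl, rfl⟩ : p = 1 ∧ q = 0 ∨ p = 0 ∧ q = 1 := by omega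
  · exact tensor_trunc_ext _ _ _
  · rw [PsiZero, tensIncl_desc]
    exact (((Category.assoc _ _ _).symm.trans (tensIncl_proj X (trunc T) 0 1 1 h =≫ _)).trans
      (Category.id_comp _)).symm

/-- The identification of the degree `0` part of the star product with `R`. -/
abbrev starZero {X Y : Cx R} (eX : X.X 0 ≃ₗ[R] R) (eY : Y.X 0 ≃ₗ[R] R) :
    (X.X 0 ⊗ Y.X 0 : ModuleCat R) ≃ₗ[R] R :=
  TensorProduct.congr eX eY ≪≫ₗ TensorProduct.lid R R

lemma tensProj_surjective (A B : Cx R) (p q n : ℕ) (h : p + q = n) :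
    Function.Surjective (tensProj A B p q n) := fun z =>
  ⟨tensIncl A B p q n h z, by
    rw [← ConcreteCategory.comp_apply, tensIncl_proj]
    rfl⟩

variable {I J I' J' : Ideal R} {X Y S T : Cx R}
  {eX : X.X 0 ≃ₗ[R] R} {eY : Y.X 0 ≃ₗ[R] R} {eS : S.X 0 ≃ₗ[R] R} {eT : T.X 0 ≃ₗ[R] R}

lemma range_starAug (hX : IsFreeResolution X (I.mkQ ∘ₗ eX.toLinearMap))
    (hY : IsFreeResolution Y (J.mkQ ∘ₗ eY.toLinearMap)) :
    LinearMap.range ((starZero eX eY).toLinearMap ∘ₗ (starAug X Y).hom) = I * J := by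
  rw [starAug_eq, ← range_lid_congr_map eX eY _ _ hX.range_d hY.range_d]
  exact LinearMap.range_comp_of_range_eq_top (f := (tensProj (trunc X) (trunc Y) 1 1 2).hom)
    ((starZero eX eY).toLinearMap ∘ₗ TensorProduct.map (X.d 1 0).hom (Y.d 1 0).hom)
    (LinearMap.range_eq_top.2 (tensProj_surjective _ _ _ _ _ rfl))

lemma range_PhiZero (hS : IsFreeResolution S (I'.mkQ ∘ₗ eS.toLinearMap))
    (φ : S ⟶ X) (hφ : ∀ s : S.X 0, eX (φ.f 0 s) = eS s) :
    LinearMap.range ((starZero eX eY).toLinearMap ∘ₗ (PhiZero φ Y).hom) = I' := by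
  have h : LinearMap.range (eX.toLinearMap ∘ₗ (S.d 1 0 ≫ φ.f 0).hom) = I' := by
    rw [← hS.range_d]
    congr 1
    ext s
    exact hφ _
  -- The factor `Y₀ ≅ R` contributes the unit ideal, so the image is the product `I' * ⊤`.
  rw [PhiZero_eq, ← Ideal.mul_top I', ← range_lid_congr_map eX eY _ _ h (range_comp_id eY)]
  exact LinearMap.range_comp_of_range_eq_top (f := (tensProj (trunc S) Y 1 0 1).hom)
    ((starZero eX eY).toLinearMap ∘ₗ TensorProduct.map (S.d 1 0 ≫ φ.f 0).hom LinearMap.id)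
    (LinearMap.range_eq_top.2 (tensProj_surjective _ _ _ _ _ rfl))

lemma range_PsiZero (hT : IsFreeResolution T (J'.mkQ ∘ₗ eT.toLinearMap))
    (ψ : T ⟶ Y) (hψ : ∀ t : T.X 0, eY (ψ.f 0 t) = eT t) :
    LinearMap.range ((starZero eX eY).toLinearMap ∘ₗ (PsiZero X ψ).hom) = J' := by
  have h : LinearMap.range (eY.toLinearMap ∘ₗ (T.d 1 0 ≫ ψ.f 0).hom) = J' := by
    rw [← hT.range_d]
    congr 1
    ext t
    exact hψ _
  rw [PsiZero_eq, ← Ideal.top_mul J', ← range_lid_congr_map eX eY _ _ (range_comp_id eX) h]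
  exact LinearMap.range_comp_of_range_eq_top (f := (tensProj X (trunc T) 0 1 1).hom)
    ((starZero eX eY).toLinearMap ∘ₗ TensorProduct.map LinearMap.id (T.d 1 0 ≫ ψ.f 0).hom)
    (LinearMap.range_eq_top.2 (tensProj_surjective _ _ _ _ _ rfl))

end
end StarResolution

/-! ### Elements of mapping cones and of biproducts. -/

namespace StarResolution

noncomputable section

variable {R : Type u} [CommRing R]

section Cone

variable {F G : Cx R} (f : F ⟶ G)

/-- The first projection of the mapping cone in degree `n + 1`. -/
abbrev coneFst (n : ℕ) : (cone f).X (n + 1) ⟶ F.X n :=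
  HomologicalComplex.homotopyCofiber.fstX f (n + 1) n rfl

/-- The second projection of the mapping cone. -/
abbrev coneSnd (n : ℕ) : (cone f).X n ⟶ G.X n :=
  HomologicalComplex.homotopyCofiber.sndX f n

/-- The first inclusion into the mapping cone. -/
abbrev coneInl (n : ℕ) : F.X n ⟶ (cone f).X (n + 1) :=
  HomologicalComplex.homotopyCofiber.inlX f n (n + 1) rfl

/-- The second inclusion into the mapping cone. -/
abbrev coneInr (n : ℕ) : G.X n ⟶ (cone f).X n :=
  HomologicalComplex.homotopyCofiber.inrX f n

lemma coneInl_fst (n : ℕ) : coneInl f n ≫ coneFst f n = 𝟙 _ :=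
  HomologicalComplex.homotopyCofiber.inlX_fstX f n (n + 1) rfl

lemma coneInl_snd (n : ℕ) : coneInl f n ≫ coneSnd f (n + 1) = 0 :=
  HomologicalComplex.homotopyCofiber.inlX_sndX f n (n + 1) rfl

lemma coneInr_fst (n : ℕ) : coneInr f (n + 1) ≫ coneFst f n = 0 :=
  HomologicalComplex.homotopyCofiber.inrX_fstX f (n + 1) n rfl

lemma coneInr_snd (n : ℕ) : coneInr f n ≫ coneSnd f n = 𝟙 _ :=
  HomologicalComplex.homotopyCofiber.inrX_sndX f n

lemma cone_id_eq (n : ℕ) : 𝟙 ((cone f).X (n + 1)) =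
    coneFst f n ≫ coneInl f n + coneSnd f (n + 1) ≫ coneInr f (n + 1) := by
  apply HomologicalComplex.homotopyCofiber.ext_to_X f (n + 1) n rfl
  · change _ ≫ coneFst f n = _ ≫ coneFst f n
    rw [Preadditive.add_comp, Category.assoc, Category.assoc, coneInl_fst, coneInr_fst]
    exact (Category.id_comp _).trans
      (((congrArg₂ (· + ·) (Category.comp_id _) comp_zero).trans (add_zero _)).symm)
  · change _ ≫ coneSnd f (n + 1) = _ ≫ coneSnd f (n + 1)
    rw [Preadditive.add_comp, Category.assoc, Category.assoc, coneInl_snd, coneInr_snd]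
    exact (Category.id_comp _).trans
      (((congrArg₂ (· + ·) comp_zero (Category.comp_id _)).trans (zero_add _)).symm)

lemma cone_elem_ext {n : ℕ} {c c' : (cone f).X (n + 1)} (h₁ : coneFst f n c = coneFst f n c')
    (h₂ : coneSnd f (n + 1) c = coneSnd f (n + 1) c') : c = c' := by
  have e (y : (cone f).X (n + 1)) : y =
      coneInl f n (coneFst f n y) + coneInr f (n + 1) (coneSnd f (n + 1) y) :=
    ConcreteCategory.congr_hom (cone_id_eq f n) y
  rw [e c, e c', h₁, h₂]

lemma exists_cone_elem {n : ℕ} (a : F.X n) (b : G.X (n + 1)) :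
    ∃ c : (cone f).X (n + 1), coneFst f n c = a ∧ coneSnd f (n + 1) c = b := by
  refine ⟨coneInl f n a + coneInr f (n + 1) b, ?_, ?_⟩
  · rw [map_add, apply_eq_zero_of_comp_eq_zero (coneInr_fst f n), add_zero]
    exact ConcreteCategory.congr_hom (coneInl_fst f n) a
  · rw [map_add, apply_eq_zero_of_comp_eq_zero (coneInl_snd f n), zero_add]
    exact ConcreteCategory.congr_hom (coneInr_snd f (n + 1)) b

lemma coneFst_d {n : ℕ} (c : (cone f).X (n + 2)) :
    coneFst f n ((cone f).d (n + 2) (n + 1) c) = -F.d (n + 1) n (coneFst f (n + 1) c) :=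
  (ConcreteCategory.congr_hom
    (HomologicalComplex.homotopyCofiber.d_fstX f (n + 2) (n + 1) n rfl rfl) c).trans
    (by simp)

lemma coneSnd_d {n : ℕ} (c : (cone f).X (n + 1)) :
    coneSnd f n ((cone f).d (n + 1) n c) =
      f.f n (coneFst f n c) + G.d (n + 1) n (coneSnd f (n + 1) c) :=
  ConcreteCategory.congr_hom
    (HomologicalComplex.homotopyCofiber.d_sndX f (n + 1) n rfl) c

lemma coneZero_apply (c : (cone f).X 0) : (coneZero f).toLinearEquiv c = coneSnd f 0 c := by
  have : coneSnd f 0 = (coneZero f).hom := dif_neg (by simp)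
  rw [this]
  rfl

/-- This is the part `H_{n+1}(G) → H_{n+1}(Cone) → H_n(F) → H_n(G)` of the long exact sequence, with
the first term zero and the last map injective. Quantifying the cycle condition over all `j` makes
it vacuous in degree 0, so `n = 0` needs no separate treatment. -/
lemma cone_exact_succ (n : ℕ)
    (hF : ∀ a : F.X n, (∀ j, F.d n j a = 0) → (∃ b, G.d (n + 1) n b = f.f n a) →
      ∃ a', F.d (n + 1) n a' = a)
    (hG : ∀ b : G.X (n + 1), G.d (n + 1) n b = 0 → ∃ b', G.d (n + 2) (n + 1) b' = b) :
    Function.Exact ((cone f).d (n + 2) (n + 1)) ((cone f).d (n + 1) n) := by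
  intro c
  constructor
  swap
  · rintro ⟨y, rfl⟩
    exact apply_eq_zero_of_comp_eq_zero ((cone f).d_comp_d _ _ _) y
  intro hc
  have h2 : f.f n (coneFst f n c) + G.d (n + 1) n (coneSnd f (n + 1) c) = 0 := by
    rw [← coneSnd_d, hc, map_zero]
  obtain ⟨a', ha'⟩ := hF (coneFst f n c)
    (fun j => by
      by_cases hj : j + 1 = n
      · subst hj
        have := coneFst_d f c
        rw [hc, map_zero] at this
        exact neg_eq_zero.1 this.symm
      · rw [F.shape n j hj]
        rfl)
    ⟨-coneSnd f (n + 1) c, by rw [map_neg, eq_neg_of_add_eq_zero_left h2]⟩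
  obtain ⟨b', hb'⟩ := hG (f.f (n + 1) a' + coneSnd f (n + 1) c) (by
    rw [map_add, ← h2, ← ha']
    exact congrArg (· + _) (apply_eq_of_comp_eq (f.comm (n + 1) n) a'))
  -- The sign of `-a'` compensates for the `-∂` in the first component of the cone differential.
  obtain ⟨y, hy₁, hy₂⟩ := exists_cone_elem f (-a') b'
  refine ⟨y, cone_elem_ext f ?_ ?_⟩
  · rw [coneFst_d, hy₁, map_neg, neg_neg, ha']
  · rw [coneSnd_d, hy₁, hy₂, hb', map_neg, neg_add_cancel_left]

lemma cone_free [∀ n, Module.Free R (F.X n)] [∀ n, Module.Free R (G.X n)] (n : ℕ) :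
    Module.Free R ((cone f).X n) := by
  match n with
  | 0 => exact Module.Free.of_equiv (coneZero f).toLinearEquiv.symm
  | n + 1 =>
    have hb : Function.Bijective
        (LinearMap.prod (coneFst f n).hom (coneSnd f (n + 1)).hom) := by
      constructor
      · intro c c' h
        exact cone_elem_ext f (congrArg Prod.fst h) (congrArg Prod.snd h)
      · rintro ⟨a, b⟩
        obtain ⟨c, h₁, h₂⟩ := exists_cone_elem f a b
        exact ⟨c, Prod.ext h₁ h₂⟩
    exact Module.Free.of_equiv (LinearEquiv.ofBijective _ hb).symm

end Cone

section Biprod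

variable {C D : Cx R}

lemma biprod_elem_eq {n : ℕ} (a : (C ⊞ D).X n) :
    (biprod.inl : C ⟶ C ⊞ D).f n ((biprod.fst : C ⊞ D ⟶ C).f n a) +
      (biprod.inr : D ⟶ C ⊞ D).f n ((biprod.snd : C ⊞ D ⟶ D).f n a) = a := by
  have e := congrArg (fun g => HomologicalComplex.Hom.f g n) (biprod.total (X := C) (Y := D))
  exact ConcreteCategory.congr_hom e a

lemma exists_biprod_elem {n : ℕ} (x : C.X n) (y : D.X n) : ∃ a : (C ⊞ D).X n,
    (biprod.fst : C ⊞ D ⟶ C).f n a = x ∧ (biprod.snd : C ⊞ D ⟶ D).f n a = y := by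
  have e {E E' : Cx R} {f g : E ⟶ E'} (h : f = g) (z : E.X n) : f.f n z = g.f n z := by rw [h]
  refine ⟨(biprod.inl : C ⟶ C ⊞ D).f n x + (biprod.inr : D ⟶ C ⊞ D).f n y, ?_, ?_⟩
  · rw [map_add]
    exact (congrArg₂ (· + ·) (e (biprod.inl_fst (X := C) (Y := D)) x)
      (e (biprod.inr_fst (X := C) (Y := D)) y)).trans (add_zero _)
  · rw [map_add]
    exact (congrArg₂ (· + ·) (e (biprod.inl_snd (X := C) (Y := D)) x)
      (e (biprod.inr_snd (X := C) (Y := D)) y)).trans (zero_add _)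

instance biprod_free [∀ n, Module.Free R (C.X n)] [∀ n, Module.Free R (D.X n)] (n : ℕ) :
    Module.Free R ((C ⊞ D).X n) :=
  Module.Free.of_equiv
    ((HomologicalComplex.biprodXIso C D n).trans (ModuleCat.biprodIsoProd _ _)).toLinearEquiv.symm

lemma biprod_desc_apply {E : Cx R} (f : C ⟶ E) (g : D ⟶ E) {n : ℕ} (a : (C ⊞ D).X n) :
    (biprod.desc f g).f n a = f.f n ((biprod.fst : C ⊞ D ⟶ C).f n a) +
      g.f n ((biprod.snd : C ⊞ D ⟶ D).f n a) := by
  have e : biprod.desc f g = biprod.fst ≫ f + biprod.snd ≫ g := by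
    apply biprod.hom_ext' <;> simp
  exact ConcreteCategory.congr_hom (congrArg (fun h => HomologicalComplex.Hom.f h n) e) a

lemma biprod_exists_d_eq {i j : ℕ} (a : (C ⊞ D).X j)
    (h₁ : ∃ x, C.d i j x = (biprod.fst : C ⊞ D ⟶ C).f j a)
    (h₂ : ∃ x, D.d i j x = (biprod.snd : C ⊞ D ⟶ D).f j a) : ∃ x, (C ⊞ D).d i j x = a := by
  obtain ⟨x, hx⟩ := h₁
  obtain ⟨y, hy⟩ := h₂
  refine ⟨(biprod.inl : C ⟶ C ⊞ D).f i x + (biprod.inr : D ⟶ C ⊞ D).f i y, ?_⟩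
  rw [← biprod_elem_eq a, ← hx, ← hy, map_add]
  exact congrArg₂ (· + ·) (apply_eq_of_comp_eq ((biprod.inl : C ⟶ C ⊞ D).comm i j) x)
    (apply_eq_of_comp_eq ((biprod.inr : D ⟶ C ⊞ D).comm i j) y)

end Biprod

end
end StarResolution

/-! ### Exactness of truncated tensor products and of the star product. -/

namespace StarResolution

noncomputable section

variable {R : Type u} [CommRing R]

section TruncatedTensor

variable {A B : Cx R}

/-- `(trunc A) ⊗ B` is the quotient of `A ⊗ B` by the column `A₀ ⊗ B`, so its homology in degree `n
+ 2` sits between that of `A ⊗ B` in degree `n + 2` and that of `A₀ ⊗ B` in degree `n + 1`. -/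
lemma exactAt_trunc_left_of_exact [∀ n, Module.Free R (A.X n)] {n : ℕ}
    (h : (tensBicomplex A B).ExactAt (n + 2))
    (hB : Function.Exact (B.d (n + 2) (n + 1)) (B.d (n + 1) n)) :
    (tensBicomplex (trunc A) B).ExactAt (n + 2) :=
  exactAt_trunc_left (h.tail fun z hz => dv_exists_of_exact A B hB 0 z hz)

lemma exactAt_trunc_right_of_exact [∀ n, Module.Free R (B.X n)] {n : ℕ}
    (h : (tensBicomplex A B).ExactAt (n + 2))
    (hA : Function.Exact (A.d (n + 2) (n + 1)) (A.d (n + 1) n)) :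
    (tensBicomplex A (trunc B)).ExactAt (n + 2) :=
  exactAt_trunc_right (h.swap.tail fun z hz => dh_exists_of_exact A B hA 0 z hz)

/-- Injectivity of the connecting map `H₁((trunc A) ⊗ B) → H₀(A₀ ⊗ B)` induced by `∂₁`. -/
lemma tens_trunc_left_exists_d_eq (h : (tensBicomplex A B).ExactAt 1) (y : (tens (trunc A) B).X 1)
    (v : (A.X 0 ⊗ B.X 1 : ModuleCat R))
    (hv : (A.d 1 0 ▷ B.X 0) (tensProj (trunc A) B 1 0 1 y) = (A.X 0 ◁ B.d 1 0) v) :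
    ∃ x, (tens (trunc A) B).d 2 1 x = y := by
  obtain ⟨w, w', hw⟩ := h.of_dh_mem (tensProj (trunc A) B 1 0 1 y) v
    (hv.trans (tensBicomplex_dv_zero_apply A B 0 v).symm)
  obtain ⟨x, hx⟩ := exists_tens_elem (A := trunc A) (B := B) 2 fun p q => match p, q with
    | 2, 0 => w
    | 1, 1 => w'
    | _, _ => 0
  refine ⟨x, tens_elem_ext fun p q hpq => ?_⟩
  obtain ⟨rfl, rfl⟩ | ⟨rfl, rfl⟩ : p = 0 ∧ q = 1 ∨ p = 1 ∧ q = 0 := by omega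
  · exact (subsingleton_of_zero_left A (B.X 1)).elim _ _
  · rw [tensProj_d_apply, hx 2 0 rfl, hx 1 1 rfl]
    exact hw

lemma tens_trunc_right_exists_d_eq (h : (tensBicomplex A B).ExactAt 1)
    (y : (tens A (trunc B)).X 1) (v : (A.X 1 ⊗ B.X 0 : ModuleCat R))
    (hv : (A.X 0 ◁ B.d 1 0) (tensProj A (trunc B) 0 1 1 y) = (A.d 1 0 ▷ B.X 0) v) :
    ∃ x, (tens A (trunc B)).d 2 1 x = y := by
  obtain ⟨w, w', hw⟩ := h.swap.of_dh_mem (tensProj A (trunc B) 0 1 1 y) v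
    ((tensBicomplex_dv_zero_apply A B 0 _).trans hv)
  obtain ⟨x, hx⟩ := exists_tens_elem (A := A) (B := trunc B) 2 fun p q => match p, q with
    | 0, 2 => w
    | 1, 1 => w'
    | _, _ => 0
  refine ⟨x, tens_elem_ext fun p q hpq => ?_⟩
  obtain ⟨rfl, rfl⟩ | ⟨rfl, rfl⟩ : p = 1 ∧ q = 0 ∨ p = 0 ∧ q = 1 := by omega
  · exact (subsingleton_of_zero_right (A.X 1) B).elim _ _
  · rw [tensProj_d_apply, hx 0 2 rfl, hx 1 1 rfl]
    exact (add_comm _ _).trans hw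

lemma star_exact_succ [∀ n, Module.Free R (A.X n)] [∀ n, Module.Free R (B.X n)]
    (h : ∀ n, (tensBicomplex A B).ExactAt (n + 1))
    (hA : ∀ n, Function.Exact (A.d (n + 2) (n + 1)) (A.d (n + 1) n))
    (hB : ∀ n, Function.Exact (B.d (n + 2) (n + 1)) (B.d (n + 1) n)) (n : ℕ)
    (y : (star A B).X (n + 1)) (hy : (star A B).d (n + 1) n y = 0) :
    ∃ x, (star A B).d (n + 2) (n + 1) x = y := by
  match n with
  | 0 =>
    have hy' : (A.d 1 0 ⊗ₘ B.d 1 0) (tensProj (trunc A) (trunc B) 1 1 2 y) = 0 :=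
      (ConcreteCategory.congr_hom (starAug_eq A B) y).symm.trans hy
    obtain ⟨w, w', hw⟩ := (h 1).of_dh_dv_eq_zero (fun z hz => dh_exists_of_exact A B (hA 0) 0 z hz)
      (fun z hz => dv_exists_of_exact A B (hB 0) 0 z hz)
      (tensProj (trunc A) (trunc B) 1 1 2 y) (by
        rw [MonoidalCategory.tensorHom_def'] at hy'
        -- In column 1 the vertical differential carries the sign `-1`, so the composite is `-(∂₁ ⊗
        -- ∂₁)`.
        refine (congrArg _ (tensBicomplex_dv_apply A B 1 0 _)).trans ?_
        rw [pow_one, Units.neg_smul, one_smul]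
        exact (map_neg (A.d 1 0 ▷ B.X 0).hom _).trans (neg_eq_zero.2 hy'))
    obtain ⟨x, hx⟩ := exists_tens_elem (A := trunc A) (B := trunc B) 3 fun p q => match p, q with
      | 2, 1 => w
      | 1, 2 => w'
      | _, _ => 0
    refine ⟨x, tens_elem_ext (A := trunc A) (B := trunc B) (n := 2) fun p q hpq => ?_⟩
    obtain ⟨rfl, rfl⟩ | ⟨rfl, rfl⟩ | ⟨rfl, rfl⟩ :
      p = 0 ∧ q = 2 ∨ p = 2 ∧ q = 0 ∨ p = 1 ∧ q = 1 := by omega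
    · exact (subsingleton_of_zero_left A ((trunc B).X 2)).elim _ _
    · exact (subsingleton_of_zero_right ((trunc A).X 2) B).elim _ _
    · refine (tensProj_d_apply (trunc A) (trunc B) 1 1 2 x).trans ?_
      rw [hx 2 1 rfl, hx 1 2 rfl]
      exact hw
  | n + 1 =>
    -- The second truncation needs exactness of `trunc A` in degree `n + 2`, inherited from `A`. It
    -- could fail in degree 1, which is why degree 1 of the star product is treated separately.
    exact tens_exists_of_exactAt (A := trunc A) (B := trunc B) (n := n + 2)
      (exactAt_trunc_right_of_exact (A := trunc A)
        (exactAt_trunc_left_of_exact (h (n + 2)) (hB (n + 1))) (hA (n + 1))) y hy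

instance star_free [∀ n, Module.Free R (A.X n)] [∀ n, Module.Free R (B.X n)] (n : ℕ) :
    Module.Free R ((star A B).X n) := by
  match n with
  | 0 => exact inferInstanceAs (Module.Free R (TensorProduct R (A.X 0) (B.X 0)))
  | n + 1 => exact tens_free (trunc A) (trunc B) (n + 2)

instance desusp_free [∀ n, Module.Free R (A.X n)] (n : ℕ) : Module.Free R ((desusp A).X n) :=
  inferInstanceAs (Module.Free R (A.X (n + 1)))

lemma desusp_exists_d_eq {n : ℕ} {y : A.X (n + 1)} (h : ∃ x, A.d (n + 2) (n + 1) x = y) :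
    ∃ x, (desusp A).d (n + 1) n x = y := by
  obtain ⟨x, rfl⟩ := h
  exact ⟨(-x : A.X (n + 2)), (congrArg Neg.neg (map_neg (A.d (n + 2) (n + 1)).hom x)).trans
    (neg_neg _)⟩

lemma d_eq_zero_of_desusp {n : ℕ} {y : A.X (n + 2)} (h : (desusp A).d (n + 1) n y = 0) :
    A.d (n + 2) (n + 1) y = 0 :=
  neg_eq_zero.1 h

end TruncatedTensor

variable {I J I' J' : Ideal R} {X Y S T : Cx R}
  {eX : X.X 0 ≃ₗ[R] R} {eY : Y.X 0 ≃ₗ[R] R} {eS : S.X 0 ≃ₗ[R] R} {eT : T.X 0 ≃ₗ[R] R}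

lemma starZero_map_eq {A A' B B' : Type*} [AddCommGroup A] [Module R A] [AddCommGroup A']
    [Module R A'] [AddCommGroup B] [Module R B] [AddCommGroup B'] [Module R B']
    (eA : A ≃ₗ[R] R) (eB : B ≃ₗ[R] R) (eA' : A' ≃ₗ[R] R) (eB' : B' ≃ₗ[R] R)
    (f : A' →ₗ[R] A) (g : B' →ₗ[R] B) (hf : ∀ x, eA (f x) = eA' x) (hg : ∀ x, eB (g x) = eB' x)
    (z : TensorProduct R A' B') :
    (TensorProduct.congr eA eB ≪≫ₗ TensorProduct.lid R R) (TensorProduct.map f g z) =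
      (TensorProduct.congr eA' eB' ≪≫ₗ TensorProduct.lid R R) z := by
  induction z using TensorProduct.induction_on with
  | zero => simp
  | add x y hx hy => rw [map_add, map_add, map_add, hx, hy]
  | tmul x y => simp [hf, hg]

/-- The image of `S₀ ⊗ Y₁` in `S₀ ⊗ Y₀ ≅ R` is `J`, so the value lies in `J` exactly when `∂₁` of
the `(1, 0)` component comes from `S₀ ⊗ Y₁`. The connecting map then shows that `a` bounds. -/
lemma PhiZero_exists_d_eq (hS : (tensBicomplex S Y).ExactAt 1)
    (hY : IsFreeResolution Y (J.mkQ ∘ₗ eY.toLinearMap))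
    (φ : S ⟶ X) (hφ : ∀ s : S.X 0, eX (φ.f 0 s) = eS s) (a : (tens (trunc S) Y).X 1)
    (ha : starZero eX eY (PhiZero φ Y a) ∈ J) : ∃ x, (tens (trunc S) Y).d 2 1 x = a := by
  set u : TensorProduct R (S.X 1) (Y.X 0) := tensProj (trunc S) Y 1 0 1 a
  have e : starZero eX eY (PhiZero φ Y a) = starZero eS eY ((S.d 1 0).hom.rTensor (Y.X 0) u) := by
    rw [PhiZero_eq]
    refine .trans ?_ (starZero_map_eq eX eY eS eY (φ.f 0).hom LinearMap.id hφ (fun _ => rfl) _)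
    exact congrArg (starZero eX eY)
      (LinearMap.congr_fun (LinearMap.rTensor_comp (Y.X 0) (φ.f 0).hom (S.d 1 0).hom) u)
  rw [e, ← Ideal.top_mul J, ← range_lid_congr_map eS eY _ _ (range_comp_id eS) hY.range_d] at ha
  obtain ⟨v, hv⟩ := ha
  exact tens_trunc_left_exists_d_eq hS a v ((starZero eS eY).injective hv.symm)

lemma PsiZero_exists_d_eq (hT : (tensBicomplex X T).ExactAt 1)
    (hX : IsFreeResolution X (I.mkQ ∘ₗ eX.toLinearMap))
    (ψ : T ⟶ Y) (hψ : ∀ t : T.X 0, eY (ψ.f 0 t) = eT t) (a : (tens X (trunc T)).X 1)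
    (ha : starZero eX eY (PsiZero X ψ a) ∈ I) : ∃ x, (tens X (trunc T)).d 2 1 x = a := by
  set u : TensorProduct R (X.X 0) (T.X 1) := tensProj X (trunc T) 0 1 1 a
  have e : starZero eX eY (PsiZero X ψ a) = starZero eX eT ((T.d 1 0).hom.lTensor (X.X 0) u) := by
    rw [PsiZero_eq]
    refine .trans ?_ (starZero_map_eq eX eY eX eT LinearMap.id (ψ.f 0).hom (fun _ => rfl) hψ _)
    exact congrArg (starZero eX eY)
      (LinearMap.congr_fun (LinearMap.lTensor_comp (X.X 0) (ψ.f 0).hom (T.d 1 0).hom) u)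
  rw [e, ← Ideal.mul_top I, ← range_lid_congr_map eX eT _ _ hX.range_d (range_comp_id eT)] at ha
  obtain ⟨v, hv⟩ := ha
  exact tens_trunc_right_exists_d_eq hT a v ((starZero eX eT).injective hv.symm)

end
end StarResolution

/-! ### The map `Ω` in coordinates, and the theorem. -/

namespace StarResolution

noncomputable section

variable {R : Type u} [CommRing R] {I J I' J' : Ideal R} {X Y S T : Cx R}
  {eX : X.X 0 ≃ₗ[R] R} {eY : Y.X 0 ≃ₗ[R] R} {eS : S.X 0 ≃ₗ[R] R} {eT : T.X 0 ≃ₗ[R] R}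

/-- Injectivity of `H₀(Ω)`, in terms of ideals. -/
lemma mem_and_mem_of_add_mem_mul (hI : I' ≤ I) (hJ : J' ≤ J) {r s : R} (hr : r ∈ I')
    (hs : s ∈ J') (h : r + s ∈ I * J) : r ∈ J ∧ s ∈ I := by
  have h₁ : r + s ∈ J := Ideal.mul_le_right h
  have h₂ : r + s ∈ I := Ideal.mul_le_left h
  exact ⟨(Ideal.add_mem_iff_left J (hJ hs)).1 h₁, (Ideal.add_mem_iff_right I (hI hr)).1 h₂⟩

/-- The component `Σ⁻¹(S_{≥ 1} ⊗ Y)` of an element of the source of `Ω`. -/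
abbrev OmegaFst (X Y S T : Cx R) (n : ℕ) :
    (desusp (tens (trunc S) Y) ⊞ desusp (tens X (trunc T))).X n ⟶ (tens (trunc S) Y).X (n + 1) :=
  (biprod.fst : desusp (tens (trunc S) Y) ⊞ desusp (tens X (trunc T)) ⟶
    desusp (tens (trunc S) Y)).f n

/-- The component `Σ⁻¹(X ⊗ T_{≥ 1})` of an element of the source of `Ω`. -/
abbrev OmegaSnd (X Y S T : Cx R) (n : ℕ) :
    (desusp (tens (trunc S) Y) ⊞ desusp (tens X (trunc T))).X n ⟶ (tens X (trunc T)).X (n + 1) :=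
  (biprod.snd : desusp (tens (trunc S) Y) ⊞ desusp (tens X (trunc T)) ⟶
    desusp (tens X (trunc T))).f n

lemma Omega_source_exists_d_eq {n : ℕ}
    (a : (desusp (tens (trunc S) Y) ⊞ desusp (tens X (trunc T))).X n)
    (h₁ : ∃ x, (tens (trunc S) Y).d (n + 2) (n + 1) x = OmegaFst X Y S T n a)
    (h₂ : ∃ x, (tens X (trunc T)).d (n + 2) (n + 1) x = OmegaSnd X Y S T n a) :
    ∃ x, (desusp (tens (trunc S) Y) ⊞ desusp (tens X (trunc T))).d (n + 1) n x = a :=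
  biprod_exists_d_eq a (desusp_exists_d_eq h₁) (desusp_exists_d_eq h₂)

lemma OmegaFst_d_eq_zero {n : ℕ}
    (a : (desusp (tens (trunc S) Y) ⊞ desusp (tens X (trunc T))).X (n + 1))
    (ha : (desusp (tens (trunc S) Y) ⊞ desusp (tens X (trunc T))).d (n + 1) n a = 0) :
    (tens (trunc S) Y).d (n + 2) (n + 1) (OmegaFst X Y S T (n + 1) a) = 0 := by
  apply d_eq_zero_of_desusp
  refine (apply_eq_of_comp_eq ((biprod.fst : desusp (tens (trunc S) Y) ⊞
    desusp (tens X (trunc T)) ⟶ desusp (tens (trunc S) Y)).comm (n + 1) n) a).trans ?_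
  rw [ha, map_zero]

lemma OmegaSnd_d_eq_zero {n : ℕ}
    (a : (desusp (tens (trunc S) Y) ⊞ desusp (tens X (trunc T))).X (n + 1))
    (ha : (desusp (tens (trunc S) Y) ⊞ desusp (tens X (trunc T))).d (n + 1) n a = 0) :
    (tens X (trunc T)).d (n + 2) (n + 1) (OmegaSnd X Y S T (n + 1) a) = 0 := by
  apply d_eq_zero_of_desusp
  refine (apply_eq_of_comp_eq ((biprod.snd : desusp (tens (trunc S) Y) ⊞
    desusp (tens X (trunc T)) ⟶ desusp (tens X (trunc T))).comm (n + 1) n) a).trans ?_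
  rw [ha, map_zero]

lemma starZero_Omega (φ : S ⟶ X) (ψ : T ⟶ Y)
    (a : (desusp (tens (trunc S) Y) ⊞ desusp (tens X (trunc T))).X 0) :
    starZero eX eY ((Omega φ ψ).f 0 a) = starZero eX eY (PhiZero φ Y (OmegaFst X Y S T 0 a)) +
      starZero eX eY (PsiZero X ψ (OmegaSnd X Y S T 0 a)) :=
  (congrArg (starZero eX eY) (biprod_desc_apply (Phi φ Y) (Psi X ψ) a)).trans
    (map_add (starZero eX eY) _ _)

lemma coneOmegaZero_d (φ : S ⟶ X) (ψ : T ⟶ Y) (c : (cone (Omega φ ψ)).X 1) :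
    coneOmegaZero φ ψ eX eY ((cone (Omega φ ψ)).d 1 0 c) =
      starZero eX eY (PhiZero φ Y (OmegaFst X Y S T 0 (coneFst (Omega φ ψ) 0 c))) +
        starZero eX eY (PsiZero X ψ (OmegaSnd X Y S T 0 (coneFst (Omega φ ψ) 0 c))) +
      starZero eX eY (starAug X Y (coneSnd (Omega φ ψ) 1 c)) := by
  rw [← starZero_Omega]
  exact (congrArg (starZero eX eY) ((coneZero_apply _ _).trans (coneSnd_d _ c))).trans
    (map_add (starZero eX eY) _ _)

lemma exists_coneOmegaZero_d_eq (φ : S ⟶ X) (ψ : T ⟶ Y) (x : (tens (trunc S) Y).X 1)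
    (y : (tens X (trunc T)).X 1) (b : (tens (trunc X) (trunc Y)).X 2) :
    ∃ c, coneOmegaZero φ ψ eX eY ((cone (Omega φ ψ)).d 1 0 c) =
      starZero eX eY (PhiZero φ Y x) + starZero eX eY (PsiZero X ψ y) +
        starZero eX eY (starAug X Y b) := by
  obtain ⟨a, hx, hy⟩ :=
    exists_biprod_elem (C := desusp (tens (trunc S) Y)) (D := desusp (tens X (trunc T))) x y
  obtain ⟨c, hc, hb⟩ := exists_cone_elem (Omega φ ψ) a b
  refine ⟨c, (coneOmegaZero_d φ ψ c).trans ?_⟩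
  rw [hc, hb]
  exact congrArg₂ (fun x' y' => starZero eX eY (PhiZero φ Y x') +
    starZero eX eY (PsiZero X ψ y') + starZero eX eY (starAug X Y b)) hx hy

end
end StarResolution

open StarResolution
theorem theorem4p6 {R : Type u} [CommRing R] (I J I' J' : Ideal R)
    (hI : I' ≤ I) (hJ : J' ≤ J)
    (hIJ : IdealTorIndependent I J) (hI'J : IdealTorIndependent I' J)
    (hIJ' : IdealTorIndependent I J')
    (X Y S T : Cx R)
    (eX : X.X 0 ≃ₗ[R] R) (eY : Y.X 0 ≃ₗ[R] R) (eS : S.X 0 ≃ₗ[R] R) (eT : T.X 0 ≃ₗ[R] R)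
    (hX : IsFreeResolution X (I.mkQ ∘ₗ eX.toLinearMap))
    (hY : IsFreeResolution Y (J.mkQ ∘ₗ eY.toLinearMap))
    (hS : IsFreeResolution S (I'.mkQ ∘ₗ eS.toLinearMap))
    (hT : IsFreeResolution T (J'.mkQ ∘ₗ eT.toLinearMap))
    (φ : S ⟶ X) (hφ : ∀ s : S.X 0, eX (φ.f 0 s) = eS s)
    (ψ : T ⟶ Y) (hψ : ∀ t : T.X 0, eY (ψ.f 0 t) = eT t) :
    IsFreeResolution (cone (Omega φ ψ))
      ((I' ⊔ I * J ⊔ J').mkQ ∘ₗ (coneOmegaZero φ ψ eX eY).toLinearMap) := by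

  have := hX.free
  have := hY.free
  have := hS.free
  have := hT.free
  have hXY := hX.exactAt_tensBicomplex hY hIJ
  have hSY := hS.exactAt_tensBicomplex hY hI'J
  have hXT := hX.exactAt_tensBicomplex hT hIJ'
  have hΦ : LinearMap.range ((starZero eX eY).toLinearMap ∘ₗ (PhiZero φ Y).hom) = I' :=
    range_PhiZero hS φ hφ
  have hΨ : LinearMap.range ((starZero eX eY).toLinearMap ∘ₗ (PsiZero X ψ).hom) = J' :=
    range_PsiZero hT ψ hψ
  have hstar := range_starAug hX hY
  refine ⟨cone_free _, fun n => ?_, fun z => ?_, ?_⟩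
  · refine cone_exact_succ _ n (fun a ha hb => ?_)
      (star_exact_succ hXY hX.exact_succ hY.exact_succ n)
    cases n with
    | zero =>
      obtain ⟨b, hb⟩ := hb
      -- The values `r ∈ I'` and `s ∈ J'` of the two components of `a` have sum in `IJ`, because `Ω
      -- a` bounds in the star product. Each component is then a boundary separately.
      obtain ⟨h₁, h₂⟩ := mem_and_mem_of_add_mem_mul hI hJ (hΦ.le ⟨OmegaFst X Y S T 0 a, rfl⟩)
        (hΨ.le ⟨OmegaSnd X Y S T 0 a, rfl⟩)
        (hstar.le ⟨b, (congrArg (starZero eX eY) hb).trans (starZero_Omega φ ψ a)⟩)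
      exact Omega_source_exists_d_eq a (PhiZero_exists_d_eq (hSY 0) hY φ hφ _ h₁)
        (PsiZero_exists_d_eq (hXT 0) hX ψ hψ _ h₂)
    | succ n =>
      -- In positive degrees both summands of the source are exact, so each component of the cycle
      -- `a` bounds.
      exact Omega_source_exists_d_eq a
        (tens_exists_of_exactAt (exactAt_trunc_left_of_exact (hSY (n + 1)) (hY.exact_succ n)) _
          (OmegaFst_d_eq_zero a (ha n)))
        (tens_exists_of_exactAt (exactAt_trunc_right_of_exact (hXT (n + 1)) (hX.exact_succ n)) _
          (OmegaSnd_d_eq_zero a (ha n)))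
  · refine (Submodule.Quotient.mk_eq_zero (I' ⊔ I * J ⊔ J')
      (x := coneOmegaZero φ ψ eX eY z)).trans ⟨fun hz => ?_, ?_⟩
    · obtain ⟨r, hr, s, hs, hrs⟩ := Submodule.mem_sup.1 hz
      obtain ⟨i, hi, t, ht, rfl⟩ := Submodule.mem_sup.1 hr
      obtain ⟨x, rfl⟩ := hΦ.ge hi
      obtain ⟨y, rfl⟩ := hΨ.ge hs
      obtain ⟨b, rfl⟩ := hstar.ge ht
      obtain ⟨c, hc⟩ := exists_coneOmegaZero_d_eq (eX := eX) (eY := eY) φ ψ x y b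
      exact ⟨c, (coneOmegaZero φ ψ eX eY).injective
        -- The cone lists the contributions in the order `I'`, `J'`, `IJ`, the ideal in the order
        -- `I'`, `IJ`, `J'`.
        (hc.trans ((add_right_comm _ _ _).trans hrs))⟩
    · rintro ⟨c, rfl⟩
      rw [coneOmegaZero_d]
      exact add_mem (add_mem (Ideal.mem_sup_left (Ideal.mem_sup_left (hΦ.le ⟨_, rfl⟩)))
        (Ideal.mem_sup_right (hΨ.le ⟨_, rfl⟩)))
        (Ideal.mem_sup_left (Ideal.mem_sup_right (hstar.le ⟨_, rfl⟩)))
  · exact (Submodule.mkQ_surjective _).comp (coneOmegaZero φ ψ eX eY).surjective
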